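/- Let $\mathbb{E}^{n+2}_2$ ($n\ge 2$) be $\mathbb{R}^{n+2}$ with $\langle v,w\rangle=-v_1w_1-v_2w_2+\sum_{i\ge 3}v_iw_i$, and let $\mathbb{H}^{n+1}_1=\{v:\langle v,v\rangle=-1\}$ be the anti-de Sitter space with Levi-Civita connection $\nabla$. Let $I\subset\mathbb{R}$ be an open interval, $\gamma:I\to\mathbb{H}^{n+1}_1$ a smooth null curve, and $(A,B,C,Z_1,\dots,Z_{n-2})$ a smooth Cartan frame field along $\gamma$ with curvature functions $k_1,\dots,k_n:I\to\mathbb{R}$. This means that these are vector fields along $\gamma$ tangent to $\mathbb{H}^{n+1}_1$ with $\langle A,B\rangle=-1$, $\langle C,C\rangle=1$, $\langle Z_i,Z_j\rangle=\delta_{ij}$, all other scalar products among them being $0$, and $$\dot\gamma=A,\quad \nabla_{\dot\gamma}A=k_1C,\quad \nabla_{\dot\gamma}C=k_2A+k_1B,\quad \nabla_{\dot\gamma}B=k_2C+k_3Z_1,$$ $$\nabla_{\dot\gamma}Z_1=k_3A+k_4Z_2,\qquad \nabla_{\dot\gamma}Z_i=-k_{i+2}Z_{i-1}+k_{i+3}Z_{i+1}\quad(2\le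 i\le n-2),$$ where terms containing a $Z_j$ with $j>n-2$ are omitted. Assume that $k_1(s)\ne0$ and $k_2(s)^2=1$ for all $s\in I$, and that $k_i$ is a non-zero constant for $3\le i\le n-2$ (nothing more is assumed of the remaining curvatures). Put $$\mathbf{x}(s,t,z)=\Big(1+\frac{|z|^2}{2}\Big)\gamma(s)+tB(s)+\sum_{j=1}^{n-2}z_jZ_j(s)-\frac{k_2|z|^2}{2}C(s),\qquad (s,t,z)\in I\times\mathbb{R}\times\mathbb{R}^{n-2}.$$ (1) The differential of $\mathbf{x}$ at $(s,t,z)$ is injective if and only if $1+k_3(s)z_1\neq 0$ (for $n=2$ this condition is void, and $\mathbf{x}$ is an immersion everywhere). (2) The set $U=\{(s,t,z)\in I\times\mathbb{R}\times\mathbb{R}^{n-2}: 1+k_3(s)z_1\ne0\}$ is open, and $\mathbf{x}|_U$ is a smooth immersion into $\mathbb{H}^{n+1}_1$ whose induced metric is Lorentzian; that is, it parametrizes an (orientable) Lorentzian hypersurface of $\mathbb{H}^{n+1}_1$. (3) For every non-empty open $V\subseteq U$ and every orientation of $V$, the pseudo-hyperbolic Gauss map $$\tilde\nu:V\to\textstyle\bigwedge^{n+1}\mathbb{E}^{n+2}_2,\qquad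 \tilde\nu(p)=\mathbf{x}(p)\wedge\mathbf{x}_*(e_1)\wedge\cdots\wedge\mathbf{x}_*(e_n),$$ where $(e_1,\dots,e_n)$ is an orthonormal frame of $T_pV$ for the induced metric compatible with the orientation, is well defined and smooth, and is of infinite type. That is, it cannot be written on $V$ as a finite sum $\phi_1+\cdots+\phi_r$ ($r\ge1$) of non-constant smooth maps $\phi_i:V\to\bigwedge^{n+1}\mathbb{E}^{n+2}_2$ with $\Delta\phi_i=\lambda_i\phi_i$, $\lambda_i\in\mathbb{R}$, where $\Delta=\sum_i\langle e_i,e_i\rangle(\nabla_{e_i}e_i-e_ie_i)$ is the Laplacian of the induced metric. -/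

import Mathlib

open scoped ContDiff

/-- The scalar product of index `s` on `ℝ^N` (the first `s` coordinates are negative). -/
def pseudoInner (s : ℕ) {N : ℕ} (v w : Fin N → ℝ) : ℝ :=
  ∑ i : Fin N, (if (i : ℕ) < s then (-1 : ℝ) else 1) * v i * w i

/-- The pseudo-hyperbolic space `H^{N-1}_{s-1}` of curvature `-1` in `E^N_s`. -/
def pseudoHyperbolicSpace (s N : ℕ) : Set (Fin N → ℝ) :=
  {v | pseudoInner s v v = -1}

/-- Levi-Civita covariant derivative, along a curve `γ` of the anti-de Sitter space
`⟨v, v⟩ = -1` in `E^N_2`, of a vector field `V` along `γ`: the component of the derivative of `V`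
tangent to the quadric. -/
noncomputable def adsCovDeriv {N : ℕ} (γ V : ℝ → Fin N → ℝ) (s : ℝ) : Fin N → ℝ :=
  deriv V s + pseudoInner 2 (deriv V s) (γ s) • γ s

/-- A finite family `v_0, …, v_{m-1}` continued by zero. -/
def extendZero {V : Type*} [Zero V] {m : ℕ} (v : Fin m → V) (i : ℕ) : V :=
  if h : i < m then v ⟨i, h⟩ else 0

/-- `(A, B, C, Z_1, …, Z_m)` is a Cartan frame field along the null curve `γ : I → H^{m+3}_1`, with
curvature functions `k 1, k 2, …, k (m+2)`. The vector `Z_{j+1}` of the mathematical notation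
is `Z j` here. -/
structure IsCartanFrame {m : ℕ} (I : Set ℝ) (γ A B C : ℝ → Fin (m + 2 + 2) → ℝ)
    (Z : Fin m → ℝ → Fin (m + 2 + 2) → ℝ) (k : ℕ → ℝ → ℝ) : Prop where
  smooth_γ : ContDiffOn ℝ ∞ γ I
  smooth_A : ContDiffOn ℝ ∞ A I
  smooth_B : ContDiffOn ℝ ∞ B I
  smooth_C : ContDiffOn ℝ ∞ C I
  smooth_Z : ∀ j, ContDiffOn ℝ ∞ (Z j) I
  mem_space : ∀ s ∈ I, γ s ∈ pseudoHyperbolicSpace 2 (m + 2 + 2)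
  tangent_A : ∀ s ∈ I, pseudoInner 2 (A s) (γ s) = 0
  tangent_B : ∀ s ∈ I, pseudoInner 2 (B s) (γ s) = 0
  tangent_C : ∀ s ∈ I, pseudoInner 2 (C s) (γ s) = 0
  tangent_Z : ∀ s ∈ I, ∀ j, pseudoInner 2 (Z j s) (γ s) = 0
  inner_A_A : ∀ s ∈ I, pseudoInner 2 (A s) (A s) = 0
  inner_B_B : ∀ s ∈ I, pseudoInner 2 (B s) (B s) = 0
  inner_A_B : ∀ s ∈ I, pseudoInner 2 (A s) (B s) = -1
  inner_A_C : ∀ s ∈ I, pseudoInner 2 (A s) (C s) = 0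
  inner_B_C : ∀ s ∈ I, pseudoInner 2 (B s) (C s) = 0
  inner_C_C : ∀ s ∈ I, pseudoInner 2 (C s) (C s) = 1
  inner_A_Z : ∀ s ∈ I, ∀ j, pseudoInner 2 (A s) (Z j s) = 0
  inner_B_Z : ∀ s ∈ I, ∀ j, pseudoInner 2 (B s) (Z j s) = 0
  inner_C_Z : ∀ s ∈ I, ∀ j, pseudoInner 2 (C s) (Z j s) = 0
  inner_Z_Z : ∀ s ∈ I, ∀ i j, pseudoInner 2 (Z i s) (Z j s) = if i = j then 1 else 0
  deriv_γ : ∀ s ∈ I, deriv γ s = A s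
  frenet_A : ∀ s ∈ I, adsCovDeriv γ A s = k 1 s • C s
  frenet_C : ∀ s ∈ I, adsCovDeriv γ C s = k 2 s • A s + k 1 s • B s
  frenet_B : ∀ s ∈ I, adsCovDeriv γ B s = k 2 s • C s + k 3 s • extendZero (fun j => Z j s) 0
  frenet_Z : ∀ s ∈ I, ∀ j : Fin m, adsCovDeriv γ (Z j) s =
    (if (j : ℕ) = 0 then k 3 s • A s
      else -(k (j + 3) s • extendZero (fun i => Z i s) (j - 1)))
    + k (j + 4) s • extendZero (fun i => Z i s) (j + 1)

/-- The coordinates `z` of a point `p = (s, t, z_1, …, z_m)`. -/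
def zCoord {m : ℕ} (p : Fin (m + 2) → ℝ) (j : Fin m) : ℝ := p j.succ.succ

/-- The map `x(s,t,z) = (1 + |z|²/2) γ + t B + ∑ z_j Z_j - (k₂|z|²/2) C`; a point of the parameter
space is `p = (s, t, z_1, …, z_m)`. -/
noncomputable def bScrollMap {m : ℕ} (γ B C : ℝ → Fin (m + 2 + 2) → ℝ)
    (Z : Fin m → ℝ → Fin (m + 2 + 2) → ℝ) (k₂ : ℝ → ℝ) (p : Fin (m + 2) → ℝ) :
    Fin (m + 2 + 2) → ℝ :=
  (1 + (∑ j, zCoord p j ^ 2) / 2) • γ (p 0) + p 1 • B (p 0) + ∑ j, zCoord p j • Z j (p 0)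
    - (k₂ (p 0) * (∑ j, zCoord p j ^ 2) / 2) • C (p 0)

/-- Partial derivative in the `i`-th coordinate. -/
noncomputable def partialDeriv {n : ℕ} (i : Fin n) (f : (Fin n → ℝ) → ℝ) (p : Fin n → ℝ) : ℝ :=
  fderiv ℝ f p (Pi.single i 1)

/-- Pull-back to the parameter space of the scalar product of `E^N_s` by `x`. -/
noncomputable def inducedInner (s : ℕ) {n N : ℕ} (x : (Fin n → ℝ) → Fin N → ℝ) (p : Fin n → ℝ)
    (v w : Fin n → ℝ) : ℝ :=
  pseudoInner s (fderiv ℝ x p v) (fderiv ℝ x p w)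

/-- Matrix of the induced metric (first fundamental form) in the coordinates. -/
noncomputable def inducedMetric (s : ℕ) {n N : ℕ} (x : (Fin n → ℝ) → Fin N → ℝ)
    (p : Fin n → ℝ) : Matrix (Fin n) (Fin n) ℝ :=
  Matrix.of fun i j => inducedInner s x p (Pi.single i 1) (Pi.single j 1)

/-- Christoffel symbols `Γ^k_{ij}` of the Levi-Civita connection of the metric `g`. -/
noncomputable def christoffel {n : ℕ} (g : (Fin n → ℝ) → Matrix (Fin n) (Fin n) ℝ)
    (k i j : Fin n) (p : Fin n → ℝ) : ℝ :=
  (1 / 2) * ∑ l, (g p)⁻¹ k l *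
    (partialDeriv i (fun q => g q j l) p + partialDeriv j (fun q => g q i l) p
      - partialDeriv l (fun q => g q i j) p)

/-- Laplacian `Δ f = -∑ g^{ij} (∂_i ∂_j f - ∑ Γ^k_{ij} ∂_k f)` of the metric `g`, which is
`∑ ε_i (∇_{e_i} e_i - e_i e_i) f` for an orthonormal frame. -/
noncomputable def laplacian {n : ℕ} (g : (Fin n → ℝ) → Matrix (Fin n) (Fin n) ℝ)
    (f : (Fin n → ℝ) → ℝ) (p : Fin n → ℝ) : ℝ :=
  -∑ i, ∑ j, (g p)⁻¹ i j *
    (partialDeriv i (partialDeriv j f) p - ∑ k, christoffel g k i j p * partialDeriv k f p)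

section FiniteType

variable {n : ℕ} {W : Type*} [AddCommGroup W] [Module ℝ W]

/-- A map from the open set `U` to a finite-dimensional real vector space `W` is smooth if its
components with respect to linear coordinates are. -/
def IsSmoothMapOn (U : Set (Fin n → ℝ)) (φ : (Fin n → ℝ) → W) : Prop :=
  ∀ l : Module.Dual ℝ W, ContDiffOn ℝ ∞ (fun p => l (φ p)) U

/-- `Δ φ = c φ` on `U`, componentwise. -/
def IsLaplaceEigenmapOn (g : (Fin n → ℝ) → Matrix (Fin n) (Fin n) ℝ) (U : Set (Fin n → ℝ))
    (φ : (Fin n → ℝ) → W) (c : ℝ) : Prop :=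
  ∀ l : Module.Dual ℝ W, ∀ p ∈ U, laplacian g (fun q => l (φ q)) p = c * l (φ p)

/-- `φ` is of finite type on `(U, g)`: a finite sum of non-constant smooth maps `ψ_i` with
`Δ ψ_i = c_i ψ_i`, `c_i` real. -/
def IsOfFiniteType (g : (Fin n → ℝ) → Matrix (Fin n) (Fin n) ℝ) (U : Set (Fin n → ℝ))
    (φ : (Fin n → ℝ) → W) : Prop :=
  ∃ (r : ℕ) (ψ : Fin r → (Fin n → ℝ) → W) (c : Fin r → ℝ), 1 ≤ r ∧
    (∀ i, IsSmoothMapOn U (ψ i) ∧ (¬ ∃ w : W, ∀ p ∈ U, ψ i p = w) ∧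
      IsLaplaceEigenmapOn g U (ψ i) (c i)) ∧
    ∀ p ∈ U, φ p = ∑ i, ψ i p

/-- A smooth map is of infinite type if it is not of finite type. -/
def IsOfInfiniteType (g : (Fin n → ℝ) → Matrix (Fin n) (Fin n) ℝ) (U : Set (Fin n → ℝ))
    (φ : (Fin n → ℝ) → W) : Prop :=
  IsSmoothMapOn U φ ∧ ¬ IsOfFiniteType g U φ

end FiniteType

/-- The `n` vectors `e_i` of the `n`-dimensional parameter space form an orthonormal frame at `p`
for the metric induced by `x`: `⟨e_i, e_j⟩ = ± δ_{ij}`. -/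
def IsOrthonormalFrame (s : ℕ) {n N : ℕ} (x : (Fin n → ℝ) → Fin N → ℝ) (p : Fin n → ℝ)
    (e : Fin n → Fin n → ℝ) : Prop :=
  (∀ i j, i ≠ j → inducedInner s x p (e i) (e j) = 0) ∧
    ∀ i, inducedInner s x p (e i) (e i) = 1 ∨ inducedInner s x p (e i) (e i) = -1

/-- The induced metric at `p` is Lorentzian, i.e. non-degenerate of index one. -/
def IsLorentzianAt (s : ℕ) {n N : ℕ} (x : (Fin n → ℝ) → Fin N → ℝ) (p : Fin n → ℝ) : Prop :=
  ∃ e, IsOrthonormalFrame s x p e ∧ ∃! i, inducedInner s x p (e i) (e i) = -1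

/-- `x` restricted to `U` is an immersed Lorentzian hypersurface of the anti-de Sitter space
`H^{n+1}_1` in `E^{n+2}_2`. -/
structure IsLorentzianHypersurface {n : ℕ} (x : (Fin n → ℝ) → Fin (n + 2) → ℝ)
    (U : Set (Fin n → ℝ)) : Prop where
  smooth : ContDiffOn ℝ ∞ x U
  mem_space : ∀ p ∈ U, x p ∈ pseudoHyperbolicSpace 2 (n + 2)
  immersion : ∀ p ∈ U, Function.Injective (fderiv ℝ x p)
  lorentzian : ∀ p ∈ U, IsLorentzianAt 2 x p

/-- An orientation of the open set `U` of `ℝ^n`: a continuous choice of sign relative to the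
standard orientation. -/
def IsOrientationOn {n : ℕ} (U : Set (Fin n → ℝ)) (σ : (Fin n → ℝ) → ℝ) : Prop :=
  ContinuousOn σ U ∧ ∀ p ∈ U, σ p = 1 ∨ σ p = -1

/-- `e` is an orthonormal frame at `p` compatible with the orientation `σ`. -/
def IsOrientedFrame (s : ℕ) {n N : ℕ} (x : (Fin n → ℝ) → Fin N → ℝ) (σ : (Fin n → ℝ) → ℝ)
    (p : Fin n → ℝ) (e : Fin n → Fin n → ℝ) : Prop :=
  IsOrthonormalFrame s x p e ∧ 0 < σ p * (Matrix.of e).det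

/-- `ν` is on `U` the pseudo-hyperbolic Gauss map `p ↦ x(p) ∧ x_*(e_1) ∧ ⋯ ∧ x_*(e_n)`, with `e`
an oriented orthonormal frame at `p`; such frames exist and the value does not depend on the
choice among them. -/
def IsPseudoHyperbolicGaussMap (s : ℕ) {n N : ℕ} (x : (Fin n → ℝ) → Fin N → ℝ)
    (U : Set (Fin n → ℝ)) (σ : (Fin n → ℝ) → ℝ)
    (ν : (Fin n → ℝ) → ⋀[ℝ]^(n + 1) (Fin N → ℝ)) : Prop :=
  ∀ p ∈ U, (∃ e, IsOrientedFrame s x σ p e) ∧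
    ∀ e, IsOrientedFrame s x σ p e →
      ν p = exteriorPower.ιMulti ℝ (n + 1)
        (Fin.cons (x p) (fun i => fderiv ℝ x p (e i)) : Fin (n + 1) → Fin N → ℝ)

/-! Everything rests on the lightlike field `η = γ - k₂C` (`nullField`). Since `k₂² = 1`, `k₂` is
locally constant and the `A`-terms cancel in `η' = -k₂k₁B`; also `B' = -η + k₃Z₁`. With it, `x = γ +
tB + ∑ z_j Z_j + (|z|²/2) η`, so `⟨x,x⟩ = -1`, `⟨x,η⟩ = -1` and `⟨x,B⟩ = 0`. Differentiating these
constants gives, without ever expanding `∂_s x`, that every tangent vector is orthogonal to `x` and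
`η`, and that `⟨∂_i x, B⟩` is `-f` for `i = s` and `0` otherwise, where `f = ⟨x,B'⟩ = 1 + k₃z₁`.

As `∂_t x = B` is null and the `∂_{z_j} x` are orthonormal and orthogonal to `B`, the factor `f`
decides both injectivity and nondegeneracy (`injective_fderiv_iff`, `isLorentzianAt_bScrollMap`).

The unit normal is `N = x - η`. Differentiating once more yields the Gauss formula `Hess x = g ⊗ η +
k₂k₁f ds² ⊗ N` (`hessian_bScrollMap`). The inverse metric has `g^{ss} = 0`, so the second term has
no trace and `Δx = -nη` with `n = m + 2`; moreover `Δ` annihilates every function of `s` alone, in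
particular the components of `η`. Hence `ΔN = -nη ≠ 0` while `Δ²N = 0`.

The Gauss map is dual to `N`: `v ∧ ν = ±⟨v,N⟩` for a fixed volume form, with a locally constant
sign. If `ν` were a finite sum of eigenmaps, each component would be a sum of eigenfunctions killed
by `Δ²`, hence already by `Δ` (`laplacian_eq_zero_of_sum_eigenfunctions`). That forces `⟨v,η⟩ = 0`
for all `v`, against `⟨γ,η⟩ = -1`. -/

/-! ### Bilinear algebra and calculus of the scalar product. -/

section PseudoInner

variable {s N : ℕ}

/-- The scalar product of index `s` as a bilinear map. -/
def pseudoForm (s N : ℕ) : (Fin N → ℝ) →ₗ[ℝ] (Fin N → ℝ) →ₗ[ℝ] ℝ :=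
  LinearMap.mk₂ ℝ (pseudoInner s)
    (fun u v w => by
      simp only [pseudoInner, Pi.add_apply, ← Finset.sum_add_distrib]
      exact Finset.sum_congr rfl fun i _ => by ring)
    (fun c u v => by
      simp only [pseudoInner, Pi.smul_apply, smul_eq_mul, Finset.mul_sum]
      exact Finset.sum_congr rfl fun i _ => by ring)
    (fun u v w => by
      simp only [pseudoInner, Pi.add_apply, ← Finset.sum_add_distrib]
      exact Finset.sum_congr rfl fun i _ => by ring)
    (fun c u v => by
      simp only [pseudoInner, Pi.smul_apply, smul_eq_mul, Finset.mul_sum]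
      exact Finset.sum_congr rfl fun i _ => by ring)

theorem pseudoForm_apply (v w : Fin N → ℝ) : pseudoForm s N v w = pseudoInner s v w := rfl

theorem pseudoInner_comm (v w : Fin N → ℝ) : pseudoInner s v w = pseudoInner s w v :=
  Finset.sum_congr rfl fun i _ => by ring

theorem pseudoInner_add_left (u v w : Fin N → ℝ) :
    pseudoInner s (u + v) w = pseudoInner s u w + pseudoInner s v w :=
  LinearMap.map_add₂ (pseudoForm s N) u v w

theorem pseudoInner_add_right (u v w : Fin N → ℝ) :
    pseudoInner s u (v + w) = pseudoInner s u v + pseudoInner s u w :=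
  (pseudoForm s N u).map_add v w

theorem pseudoInner_sub_left (u v w : Fin N → ℝ) :
    pseudoInner s (u - v) w = pseudoInner s u w - pseudoInner s v w :=
  LinearMap.map_sub₂ (pseudoForm s N) u v w

theorem pseudoInner_sub_right (u v w : Fin N → ℝ) :
    pseudoInner s u (v - w) = pseudoInner s u v - pseudoInner s u w :=
  (pseudoForm s N u).map_sub v w

theorem pseudoInner_neg_left (u w : Fin N → ℝ) : pseudoInner s (-u) w = -pseudoInner s u w :=
  LinearMap.map_neg₂ (pseudoForm s N) u w

theorem pseudoInner_neg_right (u w : Fin N → ℝ) : pseudoInner s u (-w) = -pseudoInner s u w :=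
  (pseudoForm s N u).map_neg w

theorem pseudoInner_smul_left (c : ℝ) (u w : Fin N → ℝ) :
    pseudoInner s (c • u) w = c * pseudoInner s u w :=
  LinearMap.map_smul₂ (pseudoForm s N) c u w

theorem pseudoInner_smul_right (c : ℝ) (u w : Fin N → ℝ) :
    pseudoInner s u (c • w) = c * pseudoInner s u w :=
  (pseudoForm s N u).map_smul c w

theorem pseudoInner_zero_left (w : Fin N → ℝ) : pseudoInner s 0 w = 0 :=
  LinearMap.map_zero₂ (pseudoForm s N) w

theorem pseudoInner_zero_right (w : Fin N → ℝ) : pseudoInner s w 0 = 0 :=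
  (pseudoForm s N w).map_zero

theorem pseudoInner_sum_left {ι : Type*} (t : Finset ι) (u : ι → Fin N → ℝ) (w : Fin N → ℝ) :
    pseudoInner s (∑ i ∈ t, u i) w = ∑ i ∈ t, pseudoInner s (u i) w :=
  LinearMap.map_sum₂ (pseudoForm s N) t u w

theorem pseudoInner_sum_right {ι : Type*} (t : Finset ι) (u : ι → Fin N → ℝ) (w : Fin N → ℝ) :
    pseudoInner s w (∑ i ∈ t, u i) = ∑ i ∈ t, pseudoInner s w (u i) :=
  map_sum (pseudoForm s N w) u t

theorem eq_zero_of_pseudoInner_eq_zero {w : Fin N → ℝ} (h : ∀ v, pseudoInner s w v = 0) :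
    w = 0 := by
  funext i
  have := h (Pi.single i 1)
  simp only [pseudoInner, Pi.single_apply, mul_ite, mul_one, mul_zero, Finset.sum_ite_eq',
    Finset.mem_univ, if_true] at this
  split_ifs at this <;> simpa using this

variable {E : Type*} [NormedAddCommGroup E] [NormedSpace ℝ E]

theorem hasFDerivAt_pseudoInner {a b : E → Fin N → ℝ} {a' b' : E →L[ℝ] Fin N → ℝ} {p : E}
    (ha : HasFDerivAt a a' p) (hb : HasFDerivAt b b' p) :
    ∃ L : E →L[ℝ] ℝ, HasFDerivAt (fun q => pseudoInner s (a q) (b q)) L p ∧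
      ∀ v, L v = pseudoInner s (a' v) (b p) + pseudoInner s (a p) (b' v) :=
  ⟨_, (pseudoForm s N).toContinuousBilinearMap.hasFDerivAt_of_bilinear ha hb, fun v => by
    simp [pseudoForm_apply, add_comm]⟩

theorem fderiv_pseudoInner {a b : E → Fin N → ℝ} {p : E} (ha : DifferentiableAt ℝ a p)
    (hb : DifferentiableAt ℝ b p) (v : E) :
    fderiv ℝ (fun q => pseudoInner s (a q) (b q)) p v
      = pseudoInner s (fderiv ℝ a p v) (b p) + pseudoInner s (a p) (fderiv ℝ b p v) := by
  obtain ⟨L, hL, hv⟩ := hasFDerivAt_pseudoInner (s := s) ha.hasFDerivAt hb.hasFDerivAt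
  rw [hL.fderiv, hv]

theorem deriv_pseudoInner {a b : ℝ → Fin N → ℝ} {t : ℝ} (ha : DifferentiableAt ℝ a t)
    (hb : DifferentiableAt ℝ b t) :
    deriv (fun q => pseudoInner s (a q) (b q)) t
      = pseudoInner s (deriv a t) (b t) + pseudoInner s (a t) (deriv b t) := by
  simpa using fderiv_pseudoInner (s := s) ha hb 1

theorem ContDiffOn.pseudoInner {a b : E → Fin N → ℝ} {S : Set E} {n : WithTop ℕ∞}
    (ha : ContDiffOn ℝ n a S) (hb : ContDiffOn ℝ n b S) :
    ContDiffOn ℝ n (fun q => pseudoInner s (a q) (b q)) S := by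
  unfold _root_.pseudoInner
  exact ContDiffOn.sum fun i _ => (contDiffOn_const.mul (contDiffOn_pi.1 ha i)).mul
    (contDiffOn_pi.1 hb i)

end PseudoInner

/-! ### Linearity of the Laplacian and sums of eigenfunctions. -/

section Laplacian

variable {n : ℕ}

theorem contDiffOn_partialDeriv {f : (Fin n → ℝ) → ℝ} {V : Set (Fin n → ℝ)} (hV : IsOpen V)
    (hf : ContDiffOn ℝ ∞ f V) (i : Fin n) : ContDiffOn ℝ ∞ (partialDeriv i f) V :=
  (hf.fderiv_of_isOpen hV (by simp)).clm_apply contDiffOn_const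

theorem ContDiffOn.differentiableAt_of_isOpen {E F : Type*} [NormedAddCommGroup E]
    [NormedSpace ℝ E] [NormedAddCommGroup F] [NormedSpace ℝ F] {f : E → F} {V : Set E}
    (hf : ContDiffOn ℝ ∞ f V) (hV : IsOpen V) {p : E} (hp : p ∈ V) : DifferentiableAt ℝ f p :=
  (hf.contDiffAt (hV.mem_nhds hp)).differentiableAt (by simp)

theorem partialDeriv_eventuallyEq {f h : (Fin n → ℝ) → ℝ} {p : Fin n → ℝ} (i : Fin n)
    (hfh : f =ᶠ[nhds p] h) : partialDeriv i f =ᶠ[nhds p] partialDeriv i h :=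
  (hfh.fderiv (𝕜 := ℝ)).mono fun q hq => by simp only [partialDeriv, hq]

theorem laplacian_congr (g : (Fin n → ℝ) → Matrix (Fin n) (Fin n) ℝ) {f h : (Fin n → ℝ) → ℝ}
    {p : Fin n → ℝ} (hfh : f =ᶠ[nhds p] h) : laplacian g f p = laplacian g h p := by
  simp only [laplacian, (partialDeriv_eventuallyEq _ hfh).self_of_nhds,
    (partialDeriv_eventuallyEq _ (partialDeriv_eventuallyEq _ hfh)).self_of_nhds]

theorem laplacian_zero (g : (Fin n → ℝ) → Matrix (Fin n) (Fin n) ℝ) (p : Fin n → ℝ) :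
    laplacian g (fun _ => 0) p = 0 := by
  have h : ∀ i : Fin n, partialDeriv i (fun _ => (0 : ℝ)) = fun _ => 0 := fun i => by
    funext q; simp [partialDeriv]
  simp [laplacian, h]

theorem laplacian_const_mul_add (g : (Fin n → ℝ) → Matrix (Fin n) (Fin n) ℝ)
    {f h : (Fin n → ℝ) → ℝ} {V : Set (Fin n → ℝ)} (hV : IsOpen V) (hf : ContDiffOn ℝ ∞ f V)
    (hh : ContDiffOn ℝ ∞ h V) (c : ℝ) {p : Fin n → ℝ} (hp : p ∈ V) :
    laplacian g (fun q => c * f q + h q) p = c * laplacian g f p + laplacian g h p := by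
  have key : ∀ {f h : (Fin n → ℝ) → ℝ}, ContDiffOn ℝ ∞ f V → ContDiffOn ℝ ∞ h V →
      ∀ (i : Fin n), ∀ q ∈ V, partialDeriv i (fun q => c * f q + h q) q
        = c * partialDeriv i f q + partialDeriv i h q := by
    intro f h hf hh i q hq
    have h1 := ((hf.differentiableAt_of_isOpen hV hq).hasFDerivAt.const_mul c).add
      (hh.differentiableAt_of_isOpen hV hq).hasFDerivAt
    simp only [partialDeriv]
    rw [HasFDerivAt.fderiv (f := fun q => c * f q + h q) h1]
    simp
  have key2 : ∀ i j : Fin n, partialDeriv i (partialDeriv j fun q => c * f q + h q) p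
      = c * partialDeriv i (partialDeriv j f) p + partialDeriv i (partialDeriv j h) p := by
    intro i j
    rw [← key (contDiffOn_partialDeriv hV hf j) (contDiffOn_partialDeriv hV hh j) i p hp]
    refine (partialDeriv_eventuallyEq i ?_).self_of_nhds
    filter_upwards [hV.mem_nhds hp] with q hq using key hf hh j q hq
  simp only [laplacian, key2, key hf hh _ p hp, mul_neg, ← neg_add, Finset.mul_sum,
    ← Finset.sum_add_distrib]
  congr 1
  refine Finset.sum_congr rfl fun i _ => Finset.sum_congr rfl fun j _ => ?_
  rw [Finset.sum_congr rfl fun k _ => mul_add _ _ _, Finset.sum_add_distrib]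
  have : ∑ k, christoffel g k i j p * (c * partialDeriv k f p)
      = c * ∑ k, christoffel g k i j p * partialDeriv k f p := by
    rw [Finset.mul_sum]; exact Finset.sum_congr rfl fun k _ => by ring
  rw [this]; ring

theorem laplacian_sum (g : (Fin n → ℝ) → Matrix (Fin n) (Fin n) ℝ) {ι : Type*} (t : Finset ι)
    {a : ι → (Fin n → ℝ) → ℝ} {V : Set (Fin n → ℝ)} (hV : IsOpen V)
    (ha : ∀ i, ContDiffOn ℝ ∞ (a i) V) (c : ι → ℝ) {p : Fin n → ℝ} (hp : p ∈ V) :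
    laplacian g (fun q => ∑ i ∈ t, c i * a i q) p = ∑ i ∈ t, c i * laplacian g (a i) p := by
  classical
  induction t using Finset.induction_on with
  | empty => simpa using laplacian_zero g p
  | insert i t hi ih =>
    simp only [Finset.sum_insert hi]
    rw [laplacian_const_mul_add g hV (ha i)
      (ContDiffOn.sum fun j _ => contDiffOn_const.mul (ha j)) (c i) hp, ih]

/-- Repeated and zero values `c i` are allowed, so the individual `a i` need not vanish. Let `P`
have all nonzero `c i` as roots, with `P(0) ≠ 0`, and write `P(y) = y Q(y) + P(0)`. Then `c P(c) =
0` at every `c i`, and the part `c² Q(c)` sums to zero by hypothesis; what remains is `P(0) ∑ c a =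
0`. -/
theorem sum_mul_eq_zero_of_sum_pow_mul_eq_zero {ι : Type*} [Fintype ι] (c a : ι → ℝ)
    (h : ∀ k, 2 ≤ k → ∑ i, c i ^ k * a i = 0) : ∑ i, c i * a i = 0 := by
  classical
  open Polynomial in
  have hpoly : ∀ R : ℝ[X], ∑ i, c i ^ 2 * R.eval (c i) * a i = 0 := by
    intro R
    simp only [eval_eq_sum_range, Finset.mul_sum, Finset.sum_mul]
    rw [Finset.sum_comm]
    refine Finset.sum_eq_zero fun k _ => ?_
    have := h (k + 2) (by omega)
    calc _ = R.coeff k * ∑ i, c i ^ (k + 2) * a i := by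
          rw [Finset.mul_sum]; exact Finset.sum_congr rfl fun i _ => by ring
      _ = 0 := by rw [this, mul_zero]
  set P : Polynomial ℝ := ∏ i with c i ≠ 0, (Polynomial.X - Polynomial.C (c i)) with hP
  have h0 : P.eval 0 ≠ 0 := by
    rw [hP, Polynomial.eval_prod, Finset.prod_ne_zero_iff]
    intro i hi
    simpa using (Finset.mem_filter.1 hi).2
  have hroot : ∀ i, c i * P.eval (c i) = 0 := by
    intro i
    by_cases hi : c i = 0
    · simp [hi]
    · rw [hP, Polynomial.eval_prod, Finset.prod_eq_zero (i := i) (by simp [hi]) (by simp), mul_zero]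
  have hdiv : ∀ y, P.eval y = y * P.divX.eval y + P.eval 0 := by
    intro y
    conv_lhs => rw [← P.divX_mul_X_add]
    simp [Polynomial.coeff_zero_eq_eval_zero, mul_comm]
  have : P.eval 0 * ∑ i, c i * a i = 0 := by
    calc _ = ∑ i, (c i * P.eval (c i)) * a i - ∑ i, c i ^ 2 * P.divX.eval (c i) * a i := by
          rw [Finset.mul_sum, ← Finset.sum_sub_distrib]
          exact Finset.sum_congr rfl fun i _ => by rw [hdiv (c i)]; ring
      _ = 0 := by rw [hpoly]; simp [hroot]
  exact (mul_eq_zero.1 this).resolve_left h0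

/-- A finite sum of eigenfunctions whose iterated Laplacian vanishes is harmonic. -/
theorem laplacian_eq_zero_of_sum_eigenfunctions (g : (Fin n → ℝ) → Matrix (Fin n) (Fin n) ℝ)
    {ι : Type*} [Fintype ι] {a : ι → (Fin n → ℝ) → ℝ} {c : ι → ℝ} {F G : (Fin n → ℝ) → ℝ}
    {V : Set (Fin n → ℝ)} (hV : IsOpen V) (ha : ∀ i, ContDiffOn ℝ ∞ (a i) V)
    (hc : ∀ i, ∀ p ∈ V, laplacian g (a i) p = c i * a i p) (hF : ∀ p ∈ V, F p = ∑ i, a i p)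
    (hFG : ∀ p ∈ V, laplacian g F p = G p) (hG : ∀ p ∈ V, laplacian g G p = 0) :
    ∀ p ∈ V, G p = 0 := by
  -- Each application of `Δ` multiplies the `i`-th summand by `c i`, so `F`, `G` and the iterates of
  -- `Δ` on `G` are the power sums of exponents 0, 1 and at least 2.
  have step : ∀ (H : (Fin n → ℝ) → ℝ) (k : ℕ), (∀ p ∈ V, H p = ∑ i, c i ^ k * a i p) →
      ∀ p ∈ V, laplacian g H p = ∑ i, c i ^ (k + 1) * a i p := by
    intro H k hH p hp
    rw [laplacian_congr g (Filter.eventuallyEq_of_mem (hV.mem_nhds hp) hH),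
      laplacian_sum g _ hV ha _ hp]
    exact Finset.sum_congr rfl fun i _ => by rw [hc i p hp]; ring
  have h1 : ∀ p ∈ V, G p = ∑ i, c i ^ 1 * a i p := fun p hp => by
    rw [← hFG p hp]; exact step F 0 (by simpa using hF) p hp
  have h2 : ∀ k, ∀ p ∈ V, ∑ i, c i ^ (k + 2) * a i p = 0 := by
    intro k
    induction k with
    | zero => intro p hp; rw [← hG p hp]; exact (step G 1 h1 p hp).symm
    | succ k ih =>
      intro p hp
      rw [← step (fun _ => 0) (k + 2) (fun q hq => (ih q hq).symm) p hp, laplacian_zero]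
  intro p hp
  rw [h1 p hp]
  simp only [pow_one]
  refine sum_mul_eq_zero_of_sum_pow_mul_eq_zero c (fun i => a i p) fun k hk => ?_
  obtain ⟨j, rfl⟩ := Nat.exists_eq_add_of_le' hk
  exact h2 j p hp

end Laplacian

/-! ### Coordinate derivatives, Christoffel symbols and Laplacians for an induced metric. -/

section PartialMap

variable {n : ℕ} {F : Type*} [NormedAddCommGroup F] [NormedSpace ℝ F]

/-- Partial derivative in the `i`-th coordinate of a vector-valued map. -/
noncomputable def partialMap (i : Fin n) (x : (Fin n → ℝ) → F) (p : Fin n → ℝ) : F :=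
  fderiv ℝ x p (Pi.single i 1)

theorem contDiffOn_partialMap {x : (Fin n → ℝ) → F} {V : Set (Fin n → ℝ)} (hV : IsOpen V)
    (hx : ContDiffOn ℝ ∞ x V) (i : Fin n) : ContDiffOn ℝ ∞ (partialMap i x) V :=
  (hx.fderiv_of_isOpen hV (by simp)).clm_apply contDiffOn_const

theorem fderiv_apply_eq_sum_partialMap (x : (Fin n → ℝ) → F) (p v : Fin n → ℝ) :
    fderiv ℝ x p v = ∑ i, v i • partialMap i x p := by
  conv_lhs => rw [← Finset.univ_sum_single v]
  rw [map_sum]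
  refine Finset.sum_congr rfl fun i _ => ?_
  rw [partialMap, ← map_smul, ← Pi.single_smul, smul_eq_mul, mul_one]

theorem partialMap_comm {x : (Fin n → ℝ) → F} {V : Set (Fin n → ℝ)} (hV : IsOpen V)
    (hx : ContDiffOn ℝ ∞ x V) {p : Fin n → ℝ} (hp : p ∈ V) (i j : Fin n) :
    partialMap i (partialMap j x) p = partialMap j (partialMap i x) p := by
  have hd : DifferentiableAt ℝ (fderiv ℝ x) p :=
    (hx.fderiv_of_isOpen hV (m := ∞) (by simp)).differentiableAt_of_isOpen hV hp
  have key : ∀ i j : Fin n, partialMap i (partialMap j x) p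
      = fderiv ℝ (fderiv ℝ x) p (Pi.single i 1) (Pi.single j 1) := by
    intro i j
    have h1 : HasFDerivAt (partialMap j x) _ p :=
      hd.hasFDerivAt.clm_apply (hasFDerivAt_const (Pi.single j 1 : Fin n → ℝ) p)
    rw [partialMap, h1.fderiv]
    simp
  rw [key, key]
  exact ((hx.contDiffAt (hV.mem_nhds hp)).isSymmSndFDerivAt (by simpa using! WithTop.coe_le_coe.2 (le_top (a := (2 : ℕ∞))))).eq _ _

theorem partialDeriv_congr_of_isOpen {f h : (Fin n → ℝ) → ℝ} {V : Set (Fin n → ℝ)}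
    (hV : IsOpen V) (hfh : ∀ q ∈ V, f q = h q) {p : Fin n → ℝ} (hp : p ∈ V) (i : Fin n) :
    partialDeriv i f p = partialDeriv i h p :=
  (partialDeriv_eventuallyEq i (Filter.eventuallyEq_of_mem (hV.mem_nhds hp) hfh)).self_of_nhds

theorem partialDeriv_const (c : ℝ) (i : Fin n) (p : Fin n → ℝ) :
    partialDeriv i (fun _ => c) p = 0 := by simp [partialDeriv]

end PartialMap

section InducedMetric

variable {s n N : ℕ} {x : (Fin n → ℝ) → Fin N → ℝ} {V : Set (Fin n → ℝ)} {p : Fin n → ℝ}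

theorem inducedMetric_apply (x : (Fin n → ℝ) → Fin N → ℝ) (p : Fin n → ℝ) (i j : Fin n) :
    inducedMetric s x p i j = pseudoInner s (partialMap i x p) (partialMap j x p) := rfl

theorem inducedMetric_transpose (x : (Fin n → ℝ) → Fin N → ℝ) (p : Fin n → ℝ) :
    (inducedMetric s x p).transpose = inducedMetric s x p := by
  ext i j
  exact pseudoInner_comm _ _

theorem partialDeriv_pseudoInner {a b : (Fin n → ℝ) → Fin N → ℝ} (ha : DifferentiableAt ℝ a p)
    (hb : DifferentiableAt ℝ b p) (i : Fin n) :
    partialDeriv i (fun q => pseudoInner s (a q) (b q)) p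
      = pseudoInner s (partialMap i a p) (b p) + pseudoInner s (a p) (partialMap i b p) :=
  fderiv_pseudoInner ha hb _

theorem partialDeriv_pseudoInner_const_left {b : (Fin n → ℝ) → Fin N → ℝ} (v : Fin N → ℝ)
    (hb : DifferentiableAt ℝ b p) (i : Fin n) :
    partialDeriv i (fun q => pseudoInner s v (b q)) p = pseudoInner s v (partialMap i b p) := by
  rw [partialDeriv_pseudoInner (differentiableAt_const v) hb]
  simp [partialMap, pseudoInner_zero_left]

/-- In the Koszul combination of derivatives of `⟨∂_j x, ∂_l x⟩`, symmetry of second derivatives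
cancels all terms but two copies of `⟨∂_i∂_j x, ∂_l x⟩`. -/
theorem christoffel_inducedMetric (hV : IsOpen V) (hx : ContDiffOn ℝ ∞ x V) (hp : p ∈ V)
    (k i j : Fin n) :
    christoffel (inducedMetric s x) k i j p = ∑ l, (inducedMetric s x p)⁻¹ k l *
      pseudoInner s (partialMap i (partialMap j x) p) (partialMap l x p) := by
  have hd : ∀ i, DifferentiableAt ℝ (partialMap i x) p := fun i =>
    (contDiffOn_partialMap hV hx i).differentiableAt_of_isOpen hV hp
  have hg : ∀ i j l, partialDeriv i (fun q => inducedMetric s x q j l) p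
      = pseudoInner s (partialMap i (partialMap j x) p) (partialMap l x p)
        + pseudoInner s (partialMap j x p) (partialMap i (partialMap l x) p) := fun i j l =>
    partialDeriv_pseudoInner (hd j) (hd l) i
  simp only [christoffel, hg, Finset.mul_sum]
  refine Finset.sum_congr rfl fun l _ => ?_
  rw [partialMap_comm hV hx hp j i, partialMap_comm hV hx hp l i, partialMap_comm hV hx hp l j,
    pseudoInner_comm (partialMap i x p), pseudoInner_comm (partialMap j x p),
    pseudoInner_comm (partialMap i (partialMap l x) p)]
  ring

theorem laplacian_pseudoInner_const (hV : IsOpen V) (hx : ContDiffOn ℝ ∞ x V) (hp : p ∈ V)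
    (g : (Fin n → ℝ) → Matrix (Fin n) (Fin n) ℝ) (v : Fin N → ℝ) :
    laplacian g (fun q => pseudoInner s v (x q)) p = -∑ i, ∑ j, (g p)⁻¹ i j * pseudoInner s v
      (partialMap i (partialMap j x) p - ∑ k, christoffel g k i j p • partialMap k x p) := by
  have h1 : ∀ j, ∀ q ∈ V, partialDeriv j (fun q => pseudoInner s v (x q)) q
      = pseudoInner s v (partialMap j x q) := fun j q hq =>
    partialDeriv_pseudoInner_const_left v (hx.differentiableAt_of_isOpen hV hq) j
  have h2 : ∀ i j, partialDeriv i (partialDeriv j (fun q => pseudoInner s v (x q))) p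
      = pseudoInner s v (partialMap i (partialMap j x) p) := fun i j => by
    rw [partialDeriv_congr_of_isOpen hV (h1 j) hp, partialDeriv_pseudoInner_const_left v
      ((contDiffOn_partialMap hV hx j).differentiableAt_of_isOpen hV hp)]
  simp only [laplacian, h2, h1 _ p hp, pseudoInner_sub_right, pseudoInner_sum_right,
    pseudoInner_smul_right]

theorem partialMap_comp_coord {F : Type*} [NormedAddCommGroup F] [NormedSpace ℝ F] {φ : ℝ → F}
    {c : Fin n} (hφ : DifferentiableAt ℝ φ (p c)) (i : Fin n) :
    partialMap i (fun q => φ (q c)) p = if i = c then deriv φ (p c) else 0 := by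
  have h1 : HasFDerivAt (fun q : Fin n → ℝ => φ (q c)) _ p :=
    hφ.hasFDerivAt.comp p (hasFDerivAt_apply c p)
  rw [partialMap, h1.fderiv]
  by_cases h : i = c
  · subst h; simp
  · simp [h, Ne.symm h]

/-- The Laplacian of a function of a single coordinate `c` with lightlike gradient. -/
theorem laplacian_comp_coord {I : Set ℝ} (hI : IsOpen I) {φ : ℝ → ℝ} (hφ : ContDiffOn ℝ ∞ φ I)
    {c : Fin n} (hp : p c ∈ I) (g : (Fin n → ℝ) → Matrix (Fin n) (Fin n) ℝ)
    (hcc : (g p)⁻¹ c c = 0) (hΓ : ∑ i, ∑ j, (g p)⁻¹ i j * christoffel g c i j p = 0) :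
    laplacian g (fun q => φ (q c)) p = 0 := by
  have hV : IsOpen {q : Fin n → ℝ | q c ∈ I} := hI.preimage (continuous_apply c)
  have h1 : ∀ j, ∀ q ∈ {q : Fin n → ℝ | q c ∈ I}, partialDeriv j (fun q => φ (q c)) q
      = if j = c then deriv φ (q c) else 0 := fun j q hq =>
    partialMap_comp_coord (hφ.differentiableAt_of_isOpen hI hq) j
  have hφ' : DifferentiableAt ℝ (deriv φ) (p c) :=
    (hφ.deriv_of_isOpen (m := ∞) hI (by simp)).differentiableAt_of_isOpen hI hp
  have h2 : ∀ i j, partialDeriv i (partialDeriv j (fun q => φ (q c))) p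
      = if i = c then (if j = c then deriv (deriv φ) (p c) else 0) else 0 := by
    intro i j
    rw [partialDeriv_congr_of_isOpen hV (h1 j) hp]
    by_cases hj : j = c
    · simpa [hj] using! partialMap_comp_coord hφ' i
    · simp [hj, partialDeriv_const]
  simp only [laplacian, h2, h1 _ p hp, mul_ite, mul_zero, Finset.sum_ite_eq', Finset.mem_univ,
    if_true, mul_sub, Finset.sum_sub_distrib]
  have h3 : ∑ i, ∑ j, (g p)⁻¹ i j * (christoffel g c i j p * deriv φ (p c)) = 0 := by
    simp_rw [← mul_assoc, ← Finset.sum_mul, hΓ, zero_mul]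
  simp [h3, hcc]

end InducedMetric

/-! ### The null field, its scalar products with the map, and first derivatives of the map. -/

/-- The lightlike field `γ - k₂ C` along the curve. -/
def nullField {N : ℕ} (γ C : ℝ → Fin N → ℝ) (k₂ : ℝ → ℝ) (s : ℝ) : Fin N → ℝ :=
  γ s - k₂ s • C s

theorem bScrollMap_eq {m : ℕ} (γ B C : ℝ → Fin (m + 2 + 2) → ℝ)
    (Z : Fin m → ℝ → Fin (m + 2 + 2) → ℝ) (k₂ : ℝ → ℝ) (p : Fin (m + 2) → ℝ) :
    bScrollMap γ B C Z k₂ p = γ (p 0) + p 1 • B (p 0) + ∑ j, zCoord p j • Z j (p 0)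
      + ((∑ j, zCoord p j ^ 2) / 2) • nullField γ C k₂ (p 0) := by
  simp only [bScrollMap, nullField]
  module

theorem inner_bScrollMap {m : ℕ} (γ B C : ℝ → Fin (m + 2 + 2) → ℝ)
    (Z : Fin m → ℝ → Fin (m + 2 + 2) → ℝ) (k₂ : ℝ → ℝ) (p : Fin (m + 2) → ℝ)
    (v : Fin (m + 2 + 2) → ℝ) :
    pseudoInner 2 (bScrollMap γ B C Z k₂ p) v = pseudoInner 2 (γ (p 0)) v
      + p 1 * pseudoInner 2 (B (p 0)) v + ∑ j, zCoord p j * pseudoInner 2 (Z j (p 0)) v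
      + (∑ j, zCoord p j ^ 2) / 2 * pseudoInner 2 (nullField γ C k₂ (p 0)) v := by
  simp only [bScrollMap_eq, pseudoInner_add_left, pseudoInner_smul_left, pseudoInner_sum_left]

theorem isOpen_setOf_apply_mem {n : ℕ} {I : Set ℝ} (hI : IsOpen I) (c : Fin n) :
    IsOpen {p : Fin n → ℝ | p c ∈ I} := hI.preimage (continuous_apply c)

namespace IsCartanFrame

variable {m : ℕ} {I : Set ℝ} {γ A B C : ℝ → Fin (m + 2 + 2) → ℝ}
  {Z : Fin m → ℝ → Fin (m + 2 + 2) → ℝ} {k : ℕ → ℝ → ℝ}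

section Algebra

variable (h : IsCartanFrame I γ A B C Z k) {s : ℝ} (hs : s ∈ I)
include h hs

theorem inner_γ_γ : pseudoInner 2 (γ s) (γ s) = -1 := h.mem_space s hs

/-- The `m + 4` frame vectors including `γ` are independent: pairing a relation with `γ`, `C`, `Z_j`
isolates their own coefficients, and pairing with `B` isolates that of `A` and conversely. By
dimension they span, and the scalar product is nondegenerate. -/
theorem eq_zero_of_orthogonal {w : Fin (m + 2 + 2) → ℝ} (hγ : pseudoInner 2 w (γ s) = 0)
    (hA : pseudoInner 2 w (A s) = 0) (hB : pseudoInner 2 w (B s) = 0)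
    (hC : pseudoInner 2 w (C s) = 0) (hZ : ∀ j, pseudoInner 2 w (Z j s) = 0) : w = 0 := by
  let u : Fin 4 ⊕ Fin m → Fin (m + 2 + 2) → ℝ := Sum.elim ![γ s, A s, B s, C s] fun j => Z j s
  have hu : LinearIndependent ℝ u := by
    rw [Fintype.linearIndependent_iff]
    intro c hc
    have key : ∀ v, c (.inl 0) * pseudoInner 2 (γ s) v + c (.inl 1) * pseudoInner 2 (A s) v
        + c (.inl 2) * pseudoInner 2 (B s) v + c (.inl 3) * pseudoInner 2 (C s) v
        + ∑ j, c (.inr j) * pseudoInner 2 (Z j s) v = 0 := by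
      intro v
      have := congrArg (fun y => pseudoInner 2 y v) hc
      simpa [u, Fin.sum_univ_four, pseudoInner_add_left, pseudoInner_sum_left,
        pseudoInner_smul_left, pseudoInner_zero_left] using this
    have e0 := key (γ s)
    have e1 := key (B s)
    have e2 := key (A s)
    have e3 := key (C s)
    have e4 := fun j => key (Z j s)
    simp only [h.inner_γ_γ hs, h.tangent_A s hs, h.tangent_B s hs, h.tangent_C s hs,
      h.tangent_Z s hs, h.inner_A_A s hs, h.inner_A_B s hs, h.inner_A_C s hs, h.inner_A_Z s hs,
      h.inner_B_B s hs, h.inner_B_C s hs, h.inner_B_Z s hs, h.inner_C_C s hs, h.inner_C_Z s hs,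
      h.inner_Z_Z s hs, pseudoInner_comm (γ s) _, pseudoInner_comm (B s) (A s),
      pseudoInner_comm (C s) (A s), pseudoInner_comm (C s) (B s), pseudoInner_comm (Z _ s) (A s),
      pseudoInner_comm (Z _ s) (B s), pseudoInner_comm (Z _ s) (C s), mul_zero, mul_ite, mul_one,
      Finset.sum_const_zero, Finset.sum_ite_eq', Finset.mem_univ, if_true] at e0 e1 e2 e3 e4
    rintro (i | j)
    · fin_cases i
      · change c (.inl 0) = 0; linarith
      · change c (.inl 1) = 0; linarith
      · change c (.inl 2) = 0; linarith
      · change c (.inl 3) = 0; linarith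
    · linarith [e4 j]
  have hspan := hu.span_eq_top_of_card_eq_finrank (by simp; omega)
  refine eq_zero_of_pseudoInner_eq_zero (s := 2) fun v => ?_
  have hle : Submodule.span ℝ (Set.range u) ≤ LinearMap.ker (pseudoForm 2 (m + 2 + 2) w) := by
    rw [Submodule.span_le]
    rintro _ ⟨i | j, rfl⟩
    · fin_cases i <;> assumption
    · exact hZ j
  rw [hspan] at hle
  exact hle (Submodule.mem_top (x := v))

theorem inner_deriv_γ (hI : IsOpen I) {V : ℝ → Fin (m + 2 + 2) → ℝ} (hV : ContDiffOn ℝ ∞ V I)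
    (hVγ : ∀ t ∈ I, pseudoInner 2 (V t) (γ t) = 0) :
    pseudoInner 2 (deriv V s) (γ s) = -pseudoInner 2 (V s) (A s) := by
  have h1 := deriv_pseudoInner (s := 2) (hV.differentiableAt_of_isOpen hI hs)
    (h.smooth_γ.differentiableAt_of_isOpen hI hs)
  have h2 : (fun t => pseudoInner 2 (V t) (γ t)) =ᶠ[nhds s] fun _ => 0 :=
    Filter.eventuallyEq_of_mem (hI.mem_nhds hs) hVγ
  rw [h2.deriv_eq, deriv_const, h.deriv_γ s hs] at h1
  linarith

theorem deriv_C (hI : IsOpen I) : deriv C s = k 2 s • A s + k 1 s • B s := by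
  rw [← h.frenet_C s hs, adsCovDeriv, h.inner_deriv_γ hs hI h.smooth_C h.tangent_C,
    pseudoInner_comm, h.inner_A_C s hs]
  simp

theorem deriv_B (hI : IsOpen I) :
    deriv B s = -nullField γ C (k 2) s + k 3 s • extendZero (fun j => Z j s) 0 := by
  have := h.frenet_B s hs
  rw [adsCovDeriv, h.inner_deriv_γ hs hI h.smooth_B h.tangent_B, pseudoInner_comm,
    h.inner_A_B s hs] at this
  rw [nullField, eq_sub_of_add_eq this]
  module

end Algebra

/-- The frame carries smoothness of the vector fields only; that of `k 2` is recovered from `k 2 =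
-⟨C', B⟩`. -/
theorem smooth_k2 (h : IsCartanFrame I γ A B C Z k) (hI : IsOpen I) :
    ContDiffOn ℝ ∞ (k 2) I := by
  have h1 : ContDiffOn ℝ ∞ (fun s => -pseudoInner 2 (deriv C s) (B s)) I :=
    ((h.smooth_C.deriv_of_isOpen hI (by simp)).pseudoInner h.smooth_B).neg
  refine h1.congr fun s hs => ?_
  rw [h.deriv_C hs hI, pseudoInner_add_left, pseudoInner_smul_left, pseudoInner_smul_left,
    h.inner_A_B s hs, h.inner_B_B s hs]
  ring

theorem deriv_k2 (h : IsCartanFrame I γ A B C Z k) (hI : IsOpen I)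
    (hk2 : ∀ s ∈ I, k 2 s ^ 2 = 1) {s : ℝ} (hs : s ∈ I) : deriv (k 2) s = 0 := by
  have hd := ((h.smooth_k2 hI).differentiableAt_of_isOpen hI hs).hasDerivAt
  have h1 := hd.pow 2
  have h2 : (k 2 ^ 2) =ᶠ[nhds s] fun _ => 1 := Filter.eventuallyEq_of_mem (hI.mem_nhds hs) hk2
  have h3 := h1.deriv
  rw [h2.deriv_eq, deriv_const] at h3
  have h4 : k 2 s ≠ 0 := fun h0 => by simpa [h0] using hk2 s hs
  simpa [h4] using h3.symm

theorem smooth_nullField (h : IsCartanFrame I γ A B C Z k) (hI : IsOpen I) :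
    ContDiffOn ℝ ∞ (nullField γ C (k 2)) I :=
  h.smooth_γ.sub ((h.smooth_k2 hI).smul h.smooth_C)

/-- The derivative of `k 2` vanishes, and in `A - k₂(k₂A + k₁B)` the relation `k₂² = 1` removes `A`.
-/
theorem deriv_nullField (h : IsCartanFrame I γ A B C Z k) (hI : IsOpen I)
    (hk2 : ∀ s ∈ I, k 2 s ^ 2 = 1) {s : ℝ} (hs : s ∈ I) :
    deriv (nullField γ C (k 2)) s = -(k 2 s * k 1 s) • B s := by
  have h1 := ((h.smooth_γ.differentiableAt_of_isOpen hI hs).hasDerivAt).sub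
    ((((h.smooth_k2 hI).differentiableAt_of_isOpen hI hs).hasDerivAt).smul
      ((h.smooth_C.differentiableAt_of_isOpen hI hs).hasDerivAt))
  have h2 : deriv (nullField γ C (k 2)) s = _ := h1.deriv
  rw [h2, h.deriv_γ s hs, h.deriv_k2 hI hk2 hs, h.deriv_C hs hI, smul_add, smul_smul, ← pow_two,
    hk2 s hs]
  module

section NullField

variable (h : IsCartanFrame I γ A B C Z k) {s : ℝ} (hs : s ∈ I)
include h hs

theorem inner_γ_nullField : pseudoInner 2 (γ s) (nullField γ C (k 2) s) = -1 := by
  rw [nullField, pseudoInner_sub_right, pseudoInner_smul_right, h.inner_γ_γ hs,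
    pseudoInner_comm _ (C s), h.tangent_C s hs]
  ring

theorem inner_B_nullField : pseudoInner 2 (B s) (nullField γ C (k 2) s) = 0 := by
  rw [nullField, pseudoInner_sub_right, pseudoInner_smul_right, h.tangent_B s hs,
    h.inner_B_C s hs]
  ring

theorem inner_Z_nullField (j : Fin m) :
    pseudoInner 2 (Z j s) (nullField γ C (k 2) s) = 0 := by
  rw [nullField, pseudoInner_sub_right, pseudoInner_smul_right, h.tangent_Z s hs,
    pseudoInner_comm, h.inner_C_Z s hs]
  ring

theorem inner_nullField_self (hk2 : k 2 s ^ 2 = 1) :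
    pseudoInner 2 (nullField γ C (k 2) s) (nullField γ C (k 2) s) = 0 := by
  simp only [nullField, pseudoInner_sub_right, pseudoInner_smul_right, pseudoInner_sub_left,
    pseudoInner_smul_left, h.tangent_C s hs, h.inner_γ_γ hs, pseudoInner_comm (γ s) (C s),
    h.inner_C_C s hs]
  linear_combination hk2

end NullField

section Map

variable (h : IsCartanFrame I γ A B C Z k) {p : Fin (m + 2) → ℝ} (hp : p 0 ∈ I)
include h hp

theorem inner_map_B : pseudoInner 2 (bScrollMap γ B C Z (k 2) p) (B (p 0)) = 0 := by
  rw [inner_bScrollMap]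
  simp [pseudoInner_comm _ (B (p 0)), h.tangent_B _ hp, h.inner_B_B _ hp, h.inner_B_Z _ hp,
    h.inner_B_nullField hp]

theorem inner_map_nullField (hk2 : k 2 (p 0) ^ 2 = 1) :
    pseudoInner 2 (bScrollMap γ B C Z (k 2) p) (nullField γ C (k 2) (p 0)) = -1 := by
  rw [inner_bScrollMap]
  simp [h.inner_γ_nullField hp, h.inner_Z_nullField hp, h.inner_B_nullField hp,
    h.inner_nullField_self hp hk2]

theorem inner_map_Z (j : Fin m) :
    pseudoInner 2 (bScrollMap γ B C Z (k 2) p) (Z j (p 0)) = zCoord p j := by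
  rw [inner_bScrollMap]
  simp [pseudoInner_comm (γ (p 0)) _, pseudoInner_comm (nullField γ C (k 2) (p 0)) _,
    h.tangent_Z _ hp, h.inner_B_Z _ hp, h.inner_Z_nullField hp, h.inner_Z_Z _ hp]

theorem inner_map_self (hk2 : k 2 (p 0) ^ 2 = 1) :
    pseudoInner 2 (bScrollMap γ B C Z (k 2) p) (bScrollMap γ B C Z (k 2) p) = -1 := by
  have h1 : pseudoInner 2 (γ (p 0)) (bScrollMap γ B C Z (k 2) p)
      = -1 - (∑ j, zCoord p j ^ 2) / 2 := by
    rw [pseudoInner_comm, inner_bScrollMap]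
    simp [h.inner_γ_γ hp, h.tangent_B _ hp, h.tangent_Z _ hp, h.inner_γ_nullField hp,
      pseudoInner_comm (nullField γ C (k 2) (p 0)) _]
    ring
  rw [inner_bScrollMap, h1]
  simp only [pseudoInner_comm _ (bScrollMap γ B C Z (k 2) p), h.inner_map_B hp,
    h.inner_map_Z hp, h.inner_map_nullField hp hk2, ← pow_two]
  ring

theorem inner_map_deriv_B (hI : IsOpen I) (hk2 : k 2 (p 0) ^ 2 = 1) :
    pseudoInner 2 (bScrollMap γ B C Z (k 2) p) (deriv B (p 0))
      = 1 + k 3 (p 0) * extendZero (zCoord p) 0 := by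
  rw [h.deriv_B hp hI, pseudoInner_add_right, pseudoInner_neg_right, pseudoInner_smul_right,
    h.inner_map_nullField hp hk2, neg_neg]
  congr 2
  -- For `m = 0` there is no `Z_1`: the pairing is with the zero vector and matches the coordinate
  -- extended by zero.
  unfold extendZero
  split_ifs
  · exact h.inner_map_Z hp _
  · exact pseudoInner_zero_right _

end Map

theorem smooth_bScrollMap (h : IsCartanFrame I γ A B C Z k) (hI : IsOpen I) :
    ContDiffOn ℝ ∞ (bScrollMap γ B C Z (k 2)) {p | p 0 ∈ I} := by
  have hc : ∀ {F : Type} [NormedAddCommGroup F] [NormedSpace ℝ F] {V : ℝ → F},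
      ContDiffOn ℝ ∞ V I → ContDiffOn ℝ ∞ (fun p : Fin (m + 2) → ℝ => V (p 0)) {p | p 0 ∈ I} :=
    fun hV => hV.comp (contDiff_apply ℝ ℝ 0).contDiffOn fun _ hp => hp
  have hz : ∀ j : Fin m, ContDiffOn ℝ ∞ (fun p : Fin (m + 2) → ℝ => zCoord p j) {p | p 0 ∈ I} :=
    fun j => (contDiff_apply ℝ ℝ _).contDiffOn
  refine ContDiffOn.congr ?_ fun p _ => bScrollMap_eq γ B C Z (k 2) p
  exact (((hc h.smooth_γ).add ((contDiff_apply ℝ ℝ 1).contDiffOn.smul (hc h.smooth_B))).add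
    (ContDiffOn.sum fun j _ => (hz j).smul (hc (h.smooth_Z j)))).add
    (((ContDiffOn.sum fun j _ => (hz j).pow 2).div_const 2).smul (hc (h.smooth_nullField hI)))

section Derivatives

variable (h : IsCartanFrame I γ A B C Z k) (hI : IsOpen I) {p : Fin (m + 2) → ℝ} (hp : p 0 ∈ I)
include h hI hp

theorem differentiableAt_bScrollMap : DifferentiableAt ℝ (bScrollMap γ B C Z (k 2)) p :=
  (h.smooth_bScrollMap hI).differentiableAt_of_isOpen (isOpen_setOf_apply_mem hI 0) hp

/-- Computed as a line derivative: along a `t`-line the map is affine with direction `B`. -/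
theorem partialMap_one : partialMap 1 (bScrollMap γ B C Z (k 2)) p = B (p 0) := by
  have h1 := (h.differentiableAt_bScrollMap hI hp).hasFDerivAt.hasLineDerivAt (Pi.single 1 1)
  refine HasLineDerivAt.unique h1 ?_
  have : (fun τ : ℝ => bScrollMap γ B C Z (k 2) (p + τ • Pi.single 1 1))
      = fun τ => bScrollMap γ B C Z (k 2) p + τ • B (p 0) := by
    funext τ
    have hz : zCoord (p + τ • Pi.single (M := fun _ => ℝ) 1 1) = zCoord p := by
      funext j
      simp [zCoord, Fin.ext_iff]
    simp only [bScrollMap_eq, hz]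
    simp
    module
  unfold HasLineDerivAt
  rw [this]
  simpa using ((hasDerivAt_id (0 : ℝ)).smul_const (B (p 0))).const_add
    (bScrollMap γ B C Z (k 2) p)

theorem partialMap_succ_succ (j : Fin m) :
    partialMap j.succ.succ (bScrollMap γ B C Z (k 2)) p
      = Z j (p 0) + zCoord p j • nullField γ C (k 2) (p 0) := by
  have h1 := (h.differentiableAt_bScrollMap hI hp).hasFDerivAt.hasLineDerivAt
    (Pi.single j.succ.succ 1)
  refine HasLineDerivAt.unique h1 ?_
  -- Along a `z_j`-line the map is quadratic, and `|z|²` changes by `2 z_j τ + τ²`.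
  have : (fun τ : ℝ => bScrollMap γ B C Z (k 2) (p + τ • Pi.single j.succ.succ 1))
      = fun τ => bScrollMap γ B C Z (k 2) p
        + (τ • (Z j (p 0) + zCoord p j • nullField γ C (k 2) (p 0))
          + (τ ^ 2 / 2) • nullField γ C (k 2) (p 0)) := by
    funext τ
    have hz : ∀ i, zCoord (p + τ • Pi.single (M := fun _ => ℝ) j.succ.succ 1) i
        = zCoord p i + if i = j then τ else 0 := by
      intro i
      simp [zCoord, Pi.single_apply, Fin.ext_iff]
    have h0 : (p + τ • Pi.single (M := fun _ => ℝ) j.succ.succ 1) 0 = p 0 := by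
      simp [Fin.ext_iff]
    have h1 : (p + τ • Pi.single (M := fun _ => ℝ) j.succ.succ 1) 1 = p 1 := by
      simp [Fin.ext_iff]
    have h2 : ∑ i, (zCoord p i + if i = j then τ else 0) ^ 2
        = ∑ i, zCoord p i ^ 2 + 2 * zCoord p j * τ + τ ^ 2 := by
      simp [add_sq, Finset.sum_add_distrib, ite_pow]
    simp only [bScrollMap_eq, hz, h0, h1, h2, add_smul, Finset.sum_add_distrib, ite_smul,
      zero_smul, Finset.sum_ite_eq', Finset.mem_univ, if_true]
    module
  unfold HasLineDerivAt
  rw [this]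
  have h2 := ((hasDerivAt_id (0 : ℝ)).smul_const
    (Z j (p 0) + zCoord p j • nullField γ C (k 2) (p 0))).add
    ((((hasDerivAt_id (0 : ℝ)).pow 2).div_const 2).smul_const (nullField γ C (k 2) (p 0)))
  simpa using! h2.const_add (bScrollMap γ B C Z (k 2) p)

variable (hk2 : ∀ s ∈ I, k 2 s ^ 2 = 1)
include hk2

theorem inner_partialMap_self (i : Fin (m + 2)) :
    pseudoInner 2 (partialMap i (bScrollMap γ B C Z (k 2)) p) (bScrollMap γ B C Z (k 2) p)
      = 0 := by
  have hd := h.differentiableAt_bScrollMap hI hp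
  have h1 := partialDeriv_pseudoInner (s := 2) hd hd i
  rw [partialDeriv_congr_of_isOpen (isOpen_setOf_apply_mem hI 0)
    (fun q (hq : q 0 ∈ I) => h.inner_map_self hq (hk2 _ hq)) hp, partialDeriv_const,
    pseudoInner_comm (bScrollMap γ B C Z (k 2) p)] at h1
  linarith

/-- Differentiate `⟨x,η⟩ = -1`; the extra term `⟨x,η'⟩` is a multiple of `⟨x,B⟩ = 0`. -/
theorem inner_partialMap_nullField (i : Fin (m + 2)) :
    pseudoInner 2 (partialMap i (bScrollMap γ B C Z (k 2)) p) (nullField γ C (k 2) (p 0))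
      = 0 := by
  have hn := (h.smooth_nullField hI).differentiableAt_of_isOpen hI hp
  have h1 := partialDeriv_pseudoInner (s := 2) (h.differentiableAt_bScrollMap hI hp)
    (hn.comp p (differentiableAt_apply 0 p)) i
  have h2 := partialMap_comp_coord hn i
  simp only [Function.comp_def] at h1
  rw [partialDeriv_congr_of_isOpen (isOpen_setOf_apply_mem hI 0)
    (fun q (hq : q 0 ∈ I) => h.inner_map_nullField hq (hk2 _ hq)) hp, partialDeriv_const, h2] at h1
  split_ifs at h1
  · rw [h.deriv_nullField hI hk2 hp, pseudoInner_smul_right, h.inner_map_B hp] at h1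
    linarith
  · rw [pseudoInner_zero_right] at h1
    linarith

/-- Differentiate `⟨x,B⟩ = 0`; here the extra term `⟨x,B'⟩` is the factor `1 + k₃z₁`, and it appears
only in the direction of `s`. -/
theorem inner_partialMap_B (i : Fin (m + 2)) :
    pseudoInner 2 (partialMap i (bScrollMap γ B C Z (k 2)) p) (B (p 0))
      = if i = 0 then -(1 + k 3 (p 0) * extendZero (zCoord p) 0) else 0 := by
  have hn := h.smooth_B.differentiableAt_of_isOpen hI hp
  have h1 := partialDeriv_pseudoInner (s := 2) (h.differentiableAt_bScrollMap hI hp)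
    (hn.comp p (differentiableAt_apply 0 p)) i
  have h2 := partialMap_comp_coord hn i
  simp only [Function.comp_def] at h1
  rw [partialDeriv_congr_of_isOpen (isOpen_setOf_apply_mem hI 0)
    (fun q (hq : q 0 ∈ I) => h.inner_map_B hq) hp, partialDeriv_const, h2] at h1
  split_ifs at h1 ⊢
  · rw [h.inner_map_deriv_B hp hI (hk2 _ hp)] at h1
    linarith
  · rw [pseudoInner_zero_right] at h1
    linarith

end Derivatives

end IsCartanFrame

/-! ### Immersion criterion and Lorentzian signature. -/

namespace IsCartanFrame

variable {m : ℕ} {I : Set ℝ} {γ A B C : ℝ → Fin (m + 2 + 2) → ℝ}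
  {Z : Fin m → ℝ → Fin (m + 2 + 2) → ℝ} {k : ℕ → ℝ → ℝ}

variable (h : IsCartanFrame I γ A B C Z k) (hI : IsOpen I) {p : Fin (m + 2) → ℝ} (hp : p 0 ∈ I)
include h hI hp

variable (hk2 : ∀ s ∈ I, k 2 s ^ 2 = 1)
include hk2

theorem inner_partialMap_succ_succ (i j : Fin m) :
    pseudoInner 2 (partialMap i.succ.succ (bScrollMap γ B C Z (k 2)) p)
      (partialMap j.succ.succ (bScrollMap γ B C Z (k 2)) p) = if i = j then 1 else 0 := by
  simp only [h.partialMap_succ_succ hI hp, pseudoInner_add_left, pseudoInner_add_right,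
    pseudoInner_smul_left, pseudoInner_smul_right, h.inner_Z_Z _ hp, h.inner_Z_nullField hp,
    pseudoInner_comm (nullField γ C (k 2) (p 0)) (Z _ (p 0)),
    h.inner_nullField_self hp (hk2 _ hp)]
  ring

/-- Since `∂_{z_j} x = Z_j + z_j η`, the conditions amount to orthogonality to `Z_j`, then `γ`, then
`C`, and `B`. Only the pairing with `A` is left free, and `⟨A,B⟩ = -1` fixes the coefficient. -/
theorem eq_smul_B_of_orthogonal {w : Fin (m + 2 + 2) → ℝ}
    (hx : pseudoInner 2 w (bScrollMap γ B C Z (k 2) p) = 0)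
    (hη : pseudoInner 2 w (nullField γ C (k 2) (p 0)) = 0)
    (hB : pseudoInner 2 w (B (p 0)) = 0)
    (hX : ∀ j : Fin m, pseudoInner 2 w
      (partialMap j.succ.succ (bScrollMap γ B C Z (k 2)) p) = 0) :
    w = -pseudoInner 2 w (A (p 0)) • B (p 0) := by
  have hZ : ∀ j, pseudoInner 2 w (Z j (p 0)) = 0 := fun j => by
    simpa [h.partialMap_succ_succ hI hp, pseudoInner_add_right, pseudoInner_smul_right, hη]
      using hX j
  have hγ : pseudoInner 2 w (γ (p 0)) = 0 := by
    rw [pseudoInner_comm, inner_bScrollMap] at hx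
    simpa [pseudoInner_comm _ w, hB, hZ, hη] using hx
  have hC : pseudoInner 2 w (C (p 0)) = 0 := by
    have h0 : k 2 (p 0) ≠ 0 := fun h0 => by simpa [h0] using hk2 _ hp
    rw [nullField, pseudoInner_sub_right, pseudoInner_smul_right, hγ] at hη
    simpa [h0] using hη
  rw [← sub_eq_zero]
  apply h.eq_zero_of_orthogonal hp <;>
    simp only [pseudoInner_sub_left, pseudoInner_smul_left, hγ, hB, hC, hZ, h.tangent_B _ hp,
      h.inner_B_B _ hp, h.inner_B_C _ hp, h.inner_B_Z _ hp, pseudoInner_comm (B (p 0)) (A (p 0)),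
      h.inner_A_B _ hp] <;> intros <;> ring

theorem eq_zero_of_orthogonal_partialMap {w : Fin (m + 2 + 2) → ℝ}
    (hf : 1 + k 3 (p 0) * extendZero (zCoord p) 0 ≠ 0)
    (hx : pseudoInner 2 w (bScrollMap γ B C Z (k 2) p) = 0)
    (hη : pseudoInner 2 w (nullField γ C (k 2) (p 0)) = 0)
    (hX : ∀ i, pseudoInner 2 w (partialMap i (bScrollMap γ B C Z (k 2)) p) = 0) : w = 0 := by
  have hB := hX 1
  rw [h.partialMap_one hI hp] at hB
  have hw := h.eq_smul_B_of_orthogonal hI hp hk2 hx hη hB fun j => hX _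
  have h0 := hX 0
  rw [hw, pseudoInner_smul_left, pseudoInner_comm (B (p 0)), h.inner_partialMap_B hI hp hk2,
    if_pos rfl] at h0
  have := neg_eq_zero.1 ((mul_eq_zero.1 h0).resolve_right (neg_ne_zero.2 hf))
  rw [hw, this, neg_zero, zero_smul]

/-- The part of `∂_s` orthogonal to all `∂_{z_j}`. -/
theorem exists_orthogonal_part : ∃ τ : Fin (m + 2) → ℝ, τ 0 = 1 ∧
    pseudoInner 2 (fderiv ℝ (bScrollMap γ B C Z (k 2)) p τ) (B (p 0))
      = -(1 + k 3 (p 0) * extendZero (zCoord p) 0) ∧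
    ∀ j : Fin m, pseudoInner 2 (fderiv ℝ (bScrollMap γ B C Z (k 2)) p τ)
      (partialMap j.succ.succ (bScrollMap γ B C Z (k 2)) p) = 0 := by
  refine ⟨Fin.cons 1 (Fin.cons 0 fun j => -pseudoInner 2
    (partialMap 0 (bScrollMap γ B C Z (k 2)) p)
    (partialMap j.succ.succ (bScrollMap γ B C Z (k 2)) p)), by simp, ?_, fun j => ?_⟩
  · simp [fderiv_apply_eq_sum_partialMap, Fin.sum_univ_succ, pseudoInner_add_left,
      pseudoInner_neg_left, pseudoInner_smul_left, pseudoInner_sum_left,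
      h.inner_partialMap_B hI hp hk2]
  · simp [fderiv_apply_eq_sum_partialMap, Fin.sum_univ_succ, pseudoInner_add_left,
      pseudoInner_neg_left, pseudoInner_smul_left, pseudoInner_sum_left,
      h.inner_partialMap_succ_succ hI hp hk2]

omit hI hk2 in
theorem B_ne_zero : B (p 0) ≠ 0 := fun h0 => by
  have := h.inner_A_B _ hp
  rw [h0, pseudoInner_zero_right] at this
  norm_num at this

theorem inner_fderiv_self (v : Fin (m + 2) → ℝ) :
    pseudoInner 2 (fderiv ℝ (bScrollMap γ B C Z (k 2)) p v) (bScrollMap γ B C Z (k 2) p) = 0 := by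
  rw [fderiv_apply_eq_sum_partialMap, pseudoInner_sum_left]
  simp [pseudoInner_smul_left, h.inner_partialMap_self hI hp hk2]

theorem inner_fderiv_nullField (v : Fin (m + 2) → ℝ) :
    pseudoInner 2 (fderiv ℝ (bScrollMap γ B C Z (k 2)) p v) (nullField γ C (k 2) (p 0)) = 0 := by
  rw [fderiv_apply_eq_sum_partialMap, pseudoInner_sum_left]
  simp [pseudoInner_smul_left, h.inner_partialMap_nullField hI hp hk2]

/-- If the factor vanishes, the orthogonal part `τ` of `∂_s` is sent to a multiple of `B`, which is
the image of `∂_t`, although `τ` has `s`-component 1. Otherwise, for a kernel vector, pairing with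
`B` kills the `s`-component, pairing with `∂_{z_j} x` kills the `z`-components, and `B ≠ 0` kills
the last one. -/
theorem injective_fderiv_iff : Function.Injective (fderiv ℝ (bScrollMap γ B C Z (k 2)) p) ↔
    1 + k 3 (p 0) * extendZero (zCoord p) 0 ≠ 0 := by
  constructor
  · intro hinj hf
    obtain ⟨τ, hτ0, hτB, hτX⟩ := h.exists_orthogonal_part hI hp hk2
    rw [hf, neg_zero] at hτB
    have hw := h.eq_smul_B_of_orthogonal hI hp hk2 (h.inner_fderiv_self hI hp hk2 τ)
      (h.inner_fderiv_nullField hI hp hk2 τ) hτB hτX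
    rw [← h.partialMap_one hI hp, partialMap, ← map_smul] at hw
    have := congrFun (hinj hw) 0
    simp [hτ0] at this
  · intro hf
    rw [injective_iff_map_eq_zero]
    intro v hv
    rw [fderiv_apply_eq_sum_partialMap] at hv
    have h0 : v 0 = 0 := by
      have := congrArg (fun w => pseudoInner 2 w (B (p 0))) hv
      simp only [pseudoInner_sum_left, pseudoInner_smul_left, h.inner_partialMap_B hI hp hk2,
        mul_ite, mul_zero, Finset.sum_ite_eq', Finset.mem_univ, if_true,
        pseudoInner_zero_left] at this
      exact (mul_eq_zero.1 this).resolve_right (neg_ne_zero.2 hf)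
    have h2 : ∀ j : Fin m, v j.succ.succ = 0 := by
      intro j
      have := congrArg (fun w => pseudoInner 2 w
        (partialMap j.succ.succ (bScrollMap γ B C Z (k 2)) p)) hv
      have hBX := h.inner_partialMap_B hI hp hk2 j.succ.succ
      rw [pseudoInner_comm] at hBX
      simpa [Fin.sum_univ_succ, pseudoInner_add_left, pseudoInner_smul_left, pseudoInner_sum_left,
        h.inner_partialMap_succ_succ hI hp hk2, h0, h.partialMap_one hI hp, hBX,
        pseudoInner_zero_left] using this
    have h1 : v 1 = 0 := by
      simpa [Fin.sum_univ_succ, h0, h2, h.partialMap_one hI hp, h.B_ne_zero hp] using hv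
    funext i
    refine Fin.cases h0 (fun i => Fin.cases h1 h2 i) i

theorem exists_null_transversal (hf : 1 + k 3 (p 0) * extendZero (zCoord p) 0 ≠ 0) :
    ∃ u : Fin (m + 2) → ℝ, inducedInner 2 (bScrollMap γ B C Z (k 2)) p u u = 0 ∧
      inducedInner 2 (bScrollMap γ B C Z (k 2)) p u (Pi.single 1 1) = -1 ∧
      ∀ j : Fin m, inducedInner 2 (bScrollMap γ B C Z (k 2)) p u (Pi.single j.succ.succ 1) = 0 := by
  obtain ⟨τ, -, hτB, hτX⟩ := h.exists_orthogonal_part hI hp hk2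
  set f := 1 + k 3 (p 0) * extendZero (zCoord p) 0
  set X := bScrollMap γ B C Z (k 2)
  have hX1 : fderiv ℝ X p (Pi.single 1 1) = B (p 0) := h.partialMap_one hI hp
  -- From `⟨τ, ∂_t⟩ = -f`, adding `c ∂_t` changes the square of `τ` by `-2cf`, so `c = ⟨τ,τ⟩/(2f)`
  -- makes it null; dividing by `f` normalizes the pairing with `∂_t` to `-1`.
  refine ⟨f⁻¹ • (τ + (pseudoInner 2 (fderiv ℝ X p τ) (fderiv ℝ X p τ) / (2 * f)) •
    Pi.single 1 1), ?_, ?_, fun j => ?_⟩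
  · simp only [inducedInner, map_smul, map_add, hX1, pseudoInner_smul_left, pseudoInner_smul_right,
      pseudoInner_add_left, pseudoInner_add_right, pseudoInner_comm (B (p 0)) (fderiv ℝ X p τ),
      hτB, h.inner_B_B _ hp]
    field_simp
    ring
  · simp only [inducedInner, map_smul, map_add, hX1, pseudoInner_smul_left,
      pseudoInner_add_left, hτB, h.inner_B_B _ hp]
    field_simp
    ring
  · have hBX := h.inner_partialMap_B hI hp hk2 j.succ.succ
    rw [pseudoInner_comm, if_neg (Fin.succ_ne_zero _)] at hBX
    have := hτX j
    simp only [partialMap] at this hBX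
    simp only [inducedInner, map_smul, map_add, hX1, pseudoInner_smul_left,
      pseudoInner_add_left]
    rw [this, hBX]
    ring

theorem isLorentzianAt_bScrollMap (hf : 1 + k 3 (p 0) * extendZero (zCoord p) 0 ≠ 0) :
    IsLorentzianAt 2 (bScrollMap γ B C Z (k 2)) p := by
  obtain ⟨u, huu, hu1, huX⟩ := h.exists_null_transversal hI hp hk2 hf
  set X := bScrollMap γ B C Z (k 2)
  have hX1 : fderiv ℝ X p (Pi.single 1 1) = B (p 0) := h.partialMap_one hI hp
  have hBB := h.inner_B_B _ hp
  have hBX : ∀ j : Fin m,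
      pseudoInner 2 (B (p 0)) (fderiv ℝ X p (Pi.single j.succ.succ 1)) = 0 := fun j => by
    have := h.inner_partialMap_B hI hp hk2 j.succ.succ
    rwa [pseudoInner_comm, if_neg (Fin.succ_ne_zero _)] at this
  have hXX : ∀ i j : Fin m, pseudoInner 2 (fderiv ℝ X p (Pi.single i.succ.succ 1))
      (fderiv ℝ X p (Pi.single j.succ.succ 1)) = if i = j then 1 else 0 :=
    h.inner_partialMap_succ_succ hI hp hk2
  have hcomm : ∀ v w, inducedInner 2 X p v w = inducedInner 2 X p w v := fun v w =>
    pseudoInner_comm _ _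
  have hB1 : pseudoInner 2 (B (p 0)) (fderiv ℝ X p u) = -1 := by
    rw [pseudoInner_comm, ← hX1]; exact hu1
  simp only [inducedInner, hX1] at huu hu1 huX
  -- For null vectors with product `-1`, the combinations `u ± ½ ∂_t` are orthogonal with squares
  -- `∓1`; the `∂_{z_j}` complete the frame.
  set e : Fin (m + 2) → Fin (m + 2) → ℝ := Fin.cons (u + (1 / 2 : ℝ) • Pi.single 1 1)
    (Fin.cons (u - (1 / 2 : ℝ) • Pi.single 1 1) fun j => Pi.single j.succ.succ 1) with he
  have e0 : inducedInner 2 X p (e 0) (e 0) = -1 := by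
    simp only [e, Fin.cons_zero, inducedInner, map_add, map_smul, pseudoInner_add_left,
      pseudoInner_add_right, pseudoInner_smul_left, pseudoInner_smul_right, hX1, huu, hu1, hB1, hBB]
    norm_num
  have e1 : inducedInner 2 X p (e (Fin.succ 0)) (e (Fin.succ 0)) = 1 := by
    simp only [e, Fin.cons_zero, Fin.cons_succ, inducedInner, map_sub, map_smul,
      pseudoInner_sub_left, pseudoInner_sub_right, pseudoInner_smul_left, pseudoInner_smul_right,
      hX1, huu, hu1, hB1, hBB]
    norm_num
  have e2 : ∀ i j : Fin m, inducedInner 2 X p (e i.succ.succ) (e j.succ.succ)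
      = if i = j then 1 else 0 := fun i j => hXX i j
  have e01 : inducedInner 2 X p (e 0) (e (Fin.succ 0)) = 0 := by
    simp only [e, Fin.cons_zero, Fin.cons_succ, inducedInner, map_add, map_sub, map_smul,
      pseudoInner_add_left, pseudoInner_sub_right, pseudoInner_smul_left, pseudoInner_smul_right,
      hX1, huu, hu1, hB1, hBB]
    norm_num
  have e02 : ∀ j : Fin m, inducedInner 2 X p (e 0) (e j.succ.succ) = 0 := fun j => by
    simp only [e, Fin.cons_zero, Fin.cons_succ, inducedInner, map_add, map_smul,
      pseudoInner_add_left, pseudoInner_smul_left, hX1]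
    rw [huX j, hBX j]; norm_num
  have e12 : ∀ j : Fin m, inducedInner 2 X p (e (Fin.succ 0)) (e j.succ.succ) = 0 := fun j => by
    simp only [e, Fin.cons_zero, Fin.cons_succ, inducedInner, map_sub, map_smul,
      pseudoInner_sub_left, pseudoInner_smul_left, hX1]
    rw [huX j, hBX j]; norm_num
  clear_value e
  refine ⟨e, ⟨fun i j hij => ?_, fun i => ?_⟩, 0, e0, fun i hi => ?_⟩
  · induction i using Fin.cases with
    | zero =>
      induction j using Fin.cases with
      | zero => exact absurd rfl hij
      | succ j =>
        induction j using Fin.cases with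
        | zero => exact e01
        | succ j => exact e02 j
    | succ i =>
      induction i using Fin.cases with
      | zero =>
        induction j using Fin.cases with
        | zero => rw [hcomm]; exact e01
        | succ j =>
          induction j using Fin.cases with
          | zero => exact absurd rfl hij
          | succ j => exact e12 j
      | succ i =>
        induction j using Fin.cases with
        | zero => rw [hcomm]; exact e02 i
        | succ j =>
          induction j using Fin.cases with
          | zero => rw [hcomm]; exact e12 i
          | succ j => rw [e2, if_neg fun hij' => hij (by rw [hij'])]
  · induction i using Fin.cases with
    | zero => exact .inr e0
    | succ i =>
      induction i using Fin.cases with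
      | zero => exact .inl e1
      | succ i => exact .inl (by rw [e2, if_pos rfl])
  · induction i using Fin.cases with
    | zero => rfl
    | succ i =>
      induction i using Fin.cases with
      | zero => simp only [e1] at hi; norm_num at hi
      | succ i => simp only [e2, if_true] at hi; norm_num at hi

end IsCartanFrame

/-! ### Gauss formula and Laplacians of the map and of functions of `s`. -/

namespace IsCartanFrame

variable {m : ℕ} {I : Set ℝ} {γ A B C : ℝ → Fin (m + 2 + 2) → ℝ}
  {Z : Fin m → ℝ → Fin (m + 2 + 2) → ℝ} {k : ℕ → ℝ → ℝ}

variable (h : IsCartanFrame I γ A B C Z k) (hI : IsOpen I) {p : Fin (m + 2) → ℝ} (hp : p 0 ∈ I)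
include h hI hp

theorem differentiableAt_partialMap (j : Fin (m + 2)) :
    DifferentiableAt ℝ (partialMap j (bScrollMap γ B C Z (k 2))) p :=
  (contDiffOn_partialMap (isOpen_setOf_apply_mem hI 0)
    (h.smooth_bScrollMap hI) j).differentiableAt_of_isOpen (isOpen_setOf_apply_mem hI 0) hp

variable (hk2 : ∀ s ∈ I, k 2 s ^ 2 = 1)
include hk2

theorem inner_partialMap_partialMap_self (i j : Fin (m + 2)) :
    pseudoInner 2 (partialMap i (partialMap j (bScrollMap γ B C Z (k 2))) p)
      (bScrollMap γ B C Z (k 2) p) = -inducedMetric 2 (bScrollMap γ B C Z (k 2)) p i j := by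
  have h1 := partialDeriv_pseudoInner (s := 2) (h.differentiableAt_partialMap hI hp j)
    (h.differentiableAt_bScrollMap hI hp) i
  rw [partialDeriv_congr_of_isOpen (isOpen_setOf_apply_mem hI 0)
    (fun q (hq : q 0 ∈ I) => h.inner_partialMap_self hI hq hk2 j) hp, partialDeriv_const] at h1
  rw [inducedMetric_apply, pseudoInner_comm (partialMap i (bScrollMap γ B C Z (k 2)) p)]
  linarith

/-- Differentiate `⟨∂_j x, η⟩ = 0` and use `η' = -k₂k₁B`: this is the second fundamental form up to
sign, concentrated on `ds²`. -/
theorem inner_partialMap_partialMap_nullField (i j : Fin (m + 2)) :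
    pseudoInner 2 (partialMap i (partialMap j (bScrollMap γ B C Z (k 2))) p)
      (nullField γ C (k 2) (p 0)) = if i = 0 ∧ j = 0 then
        -(k 2 (p 0) * k 1 (p 0) * (1 + k 3 (p 0) * extendZero (zCoord p) 0)) else 0 := by
  have hn := (h.smooth_nullField hI).differentiableAt_of_isOpen hI hp
  have h1 := partialDeriv_pseudoInner (s := 2) (h.differentiableAt_partialMap hI hp j)
    (hn.comp p (differentiableAt_apply 0 p)) i
  have h2 := partialMap_comp_coord hn i
  simp only [Function.comp_def] at h1
  rw [partialDeriv_congr_of_isOpen (isOpen_setOf_apply_mem hI 0)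
    (fun q (hq : q 0 ∈ I) => h.inner_partialMap_nullField hI hq hk2 j) hp, partialDeriv_const,
    h2, h.deriv_nullField hI hk2 hp] at h1
  rw [ite_and]
  split_ifs at h1 ⊢ with hi hj
  · rw [pseudoInner_smul_right, h.inner_partialMap_B hI hp hk2, if_pos hj] at h1
    linarith
  · rw [pseudoInner_smul_right, h.inner_partialMap_B hI hp hk2, if_neg hj] at h1
    linarith
  · rw [pseudoInner_zero_right] at h1
    linarith

theorem inner_partialMap_partialMap_B {i j : Fin (m + 2)} (hi : i ≠ 0) (hj : j ≠ 0) :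
    pseudoInner 2 (partialMap i (partialMap j (bScrollMap γ B C Z (k 2))) p) (B (p 0)) = 0 := by
  have hn := h.smooth_B.differentiableAt_of_isOpen hI hp
  have h1 := partialDeriv_pseudoInner (s := 2) (h.differentiableAt_partialMap hI hp j)
    (hn.comp p (differentiableAt_apply 0 p)) i
  have h2 := partialMap_comp_coord hn i
  simp only [Function.comp_def] at h1
  rw [partialDeriv_congr_of_isOpen (isOpen_setOf_apply_mem hI 0)
    (fun q (hq : q 0 ∈ I) => h.inner_partialMap_B hI hq hk2 j) hp, h2, if_neg hi,
    pseudoInner_zero_right] at h1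
  simp only [if_neg hj, partialDeriv_const] at h1
  linarith

omit hk2 in
theorem inner_partialMap_zero_partialMap_one :
    pseudoInner 2 (partialMap 0 (partialMap 1 (bScrollMap γ B C Z (k 2))) p) (B (p 0)) = 0 := by
  have hn := h.smooth_B.differentiableAt_of_isOpen hI hp
  have hev : partialMap 1 (bScrollMap γ B C Z (k 2)) =ᶠ[nhds p] fun q => B (q 0) :=
    Filter.eventuallyEq_of_mem ((isOpen_setOf_apply_mem hI 0).mem_nhds hp)
      fun q hq => h.partialMap_one hI hq
  rw [partialMap, hev.fderiv_eq]
  change pseudoInner 2 (partialMap 0 (fun q => B (q 0)) p) _ = 0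
  rw [partialMap_comp_coord hn, if_pos rfl]
  have h1 := deriv_pseudoInner (s := 2) hn hn
  have hBB : (fun t => pseudoInner 2 (B t) (B t)) =ᶠ[nhds (p 0)] fun _ => 0 :=
    Filter.eventuallyEq_of_mem (hI.mem_nhds hp) h.inner_B_B
  rw [hBB.deriv_eq, deriv_const, pseudoInner_comm (B (p 0))] at h1
  linarith

variable (hf : 1 + k 3 (p 0) * extendZero (zCoord p) 0 ≠ 0)
  (hdet : IsUnit (inducedMetric 2 (bScrollMap γ B C Z (k 2)) p).det)
include hf hdet

/-- Column `t` of the metric is `⟨∂_i x, B⟩`, which has the single entry `-f` in row `s`. Hence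
entry `(i, t)` of `g⁻¹ g = 1` reads `-f g^{is} = 0` when `i` is not `t`. -/
theorem inv_inducedMetric_apply_zero {i : Fin (m + 2)} (hi : i ≠ 1) :
    (inducedMetric 2 (bScrollMap γ B C Z (k 2)) p)⁻¹ i 0 = 0 := by
  have h1 := congrFun (congrFun (Matrix.nonsing_inv_mul _ hdet) i) 1
  rw [Matrix.one_apply_ne hi, Matrix.mul_apply] at h1
  simp only [inducedMetric_apply _ _ _ 1, h.partialMap_one hI hp,
    h.inner_partialMap_B hI hp hk2, mul_ite, mul_zero, Finset.sum_ite_eq', Finset.mem_univ,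
    if_true] at h1
  exact (mul_eq_zero.1 h1).resolve_right (neg_ne_zero.2 hf)

theorem inv_inducedMetric_zero_apply {i : Fin (m + 2)} (hi : i ≠ 1) :
    (inducedMetric 2 (bScrollMap γ B C Z (k 2)) p)⁻¹ 0 i = 0 := by
  rw [← h.inv_inducedMetric_apply_zero hI hp hk2 hf hdet hi, ← Matrix.transpose_apply
    (inducedMetric 2 (bScrollMap γ B C Z (k 2)) p)⁻¹, Matrix.transpose_nonsing_inv,
    inducedMetric_transpose]

/-- The Gauss formula: second derivatives split into a tangential and a normal part. -/
theorem hessian_bScrollMap (i j : Fin (m + 2)) :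
    partialMap i (partialMap j (bScrollMap γ B C Z (k 2))) p
      - ∑ a, christoffel (inducedMetric 2 (bScrollMap γ B C Z (k 2))) a i j p •
        partialMap a (bScrollMap γ B C Z (k 2)) p
    = inducedMetric 2 (bScrollMap γ B C Z (k 2)) p i j • nullField γ C (k 2) (p 0)
      + (if i = 0 ∧ j = 0 then
        k 2 (p 0) * k 1 (p 0) * (1 + k 3 (p 0) * extendZero (zCoord p) 0) else 0) •
        (bScrollMap γ B C Z (k 2) p - nullField γ C (k 2) (p 0)) := by
  rw [← sub_eq_zero]
  -- The difference of the two sides is tested against `x`, `η` and the tangent vectors. As `⟨N,x⟩ =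
  -- 0` and `⟨η,x⟩ = -1`, `x` detects the coefficient of `η`; as `⟨η,η⟩ = 0` and `⟨N,η⟩ = -1`, `η`
  -- detects that of `N`.
  refine h.eq_zero_of_orthogonal_partialMap hI hp hk2 hf ?_ ?_ fun l => ?_
  · simp only [pseudoInner_sub_left, pseudoInner_add_left, pseudoInner_sum_left,
      pseudoInner_smul_left, h.inner_partialMap_partialMap_self hI hp hk2,
      h.inner_partialMap_self hI hp hk2, h.inner_map_self hp (hk2 _ hp),
      pseudoInner_comm (nullField γ C (k 2) (p 0)) (bScrollMap γ B C Z (k 2) p),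
      h.inner_map_nullField hp (hk2 _ hp), mul_zero, Finset.sum_const_zero]
    ring
  · simp only [pseudoInner_sub_left, pseudoInner_add_left, pseudoInner_sum_left,
      pseudoInner_smul_left, h.inner_partialMap_partialMap_nullField hI hp hk2,
      h.inner_partialMap_nullField hI hp hk2, h.inner_nullField_self hp (hk2 _ hp),
      h.inner_map_nullField hp (hk2 _ hp), mul_zero, Finset.sum_const_zero]
    split_ifs <;> ring
  -- The Christoffel sum is the tangential projection of the second derivative: lowering its index
  -- undoes the inverse metric.
  · have hproj : ∑ a, christoffel (inducedMetric 2 (bScrollMap γ B C Z (k 2))) a i j p *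
        inducedMetric 2 (bScrollMap γ B C Z (k 2)) p a l
        = pseudoInner 2 (partialMap i (partialMap j (bScrollMap γ B C Z (k 2))) p)
          (partialMap l (bScrollMap γ B C Z (k 2)) p) := by
      simp only [christoffel_inducedMetric (isOpen_setOf_apply_mem hI 0)
        (h.smooth_bScrollMap hI) hp, Finset.sum_mul]
      rw [Finset.sum_comm]
      set G := inducedMetric 2 (bScrollMap γ B C Z (k 2)) p with hG
      have hinv : ∀ b, ∑ a, G⁻¹ a b * G a l = if b = l then 1 else 0 := by
        intro b
        have h1 := congrFun (congrFun (Matrix.nonsing_inv_mul G hdet) b) l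
        rw [Matrix.mul_apply, Matrix.one_apply] at h1
        rw [← h1]
        refine Finset.sum_congr rfl fun a _ => ?_
        rw [← Matrix.transpose_apply G⁻¹, Matrix.transpose_nonsing_inv, hG,
          inducedMetric_transpose]
      calc _ = ∑ b, pseudoInner 2 (partialMap i (partialMap j (bScrollMap γ B C Z (k 2))) p)
            (partialMap b (bScrollMap γ B C Z (k 2)) p) * ∑ a, G⁻¹ a b * G a l :=
            Finset.sum_congr rfl fun b _ => by
              rw [Finset.mul_sum]; exact Finset.sum_congr rfl fun a _ => by ring
        _ = _ := by simp [hinv]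
    simp only [inducedMetric_apply _ _ _ l] at hproj
    simp only [pseudoInner_sub_left, pseudoInner_add_left, pseudoInner_sum_left,
      pseudoInner_smul_left, hproj,
      pseudoInner_comm (bScrollMap γ B C Z (k 2) p), pseudoInner_comm (nullField γ C (k 2) (p 0)),
      h.inner_partialMap_self hI hp hk2, h.inner_partialMap_nullField hI hp hk2]
    ring

/-- Trace of the Gauss formula: the metric contributes `m + 2`, and the `ds²` term drops out because
`g^{ss} = 0`. -/
theorem laplacian_inner_bScrollMap (v : Fin (m + 2 + 2) → ℝ) :
    laplacian (inducedMetric 2 (bScrollMap γ B C Z (k 2)))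
      (fun q => pseudoInner 2 v (bScrollMap γ B C Z (k 2) q)) p
    = -((m + 2 : ℝ) * pseudoInner 2 v (nullField γ C (k 2) (p 0))) := by
  rw [laplacian_pseudoInner_const (isOpen_setOf_apply_mem hI 0) (h.smooth_bScrollMap hI) hp]
  simp only [h.hessian_bScrollMap hI hp hk2 hf hdet, pseudoInner_add_right, pseudoInner_smul_right,
    mul_add, Finset.sum_add_distrib]
  set G := inducedMetric 2 (bScrollMap γ B C Z (k 2)) p with hG
  have htr : ∑ i, ∑ j, G⁻¹ i j * G i j = m + 2 := by
    have h1 := congrArg Matrix.trace (Matrix.nonsing_inv_mul G hdet)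
    rw [Matrix.trace_one, Fintype.card_fin] at h1
    push_cast at h1
    rw [← h1, Matrix.trace]
    refine Finset.sum_congr rfl fun i _ => ?_
    rw [Matrix.diag_apply, Matrix.mul_apply]
    refine Finset.sum_congr rfl fun j _ => ?_
    rw [← Matrix.transpose_apply G, hG, inducedMetric_transpose]
  have h0 : G⁻¹ 0 0 = 0 := h.inv_inducedMetric_apply_zero hI hp hk2 hf hdet (by simp)
  simp only [← mul_assoc, ← Finset.sum_mul, htr]
  have h2 : ∀ c : ℝ, ∑ i, ∑ j, G⁻¹ i j * (if i = 0 ∧ j = 0 then c else 0) = 0 := fun c => by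
    simp [ite_and, h0]
  rw [h2]
  ring

/-- Row `s` of the inverse metric only has its `t`-entry, so `Γ^s_{ij}` is a multiple of `⟨∂_i∂_j x,
B⟩`. This vanishes when neither index is `s`; among the other pairs only `(s,t)` and `(t,s)` carry a
possibly nonzero `g^{ij}`, and there `∂_s∂_t x = B'` is orthogonal to `B`. -/
theorem laplacian_comp_apply_zero {φ : ℝ → ℝ} (hφ : ContDiffOn ℝ ∞ φ I) :
    laplacian (inducedMetric 2 (bScrollMap γ B C Z (k 2))) (fun q => φ (q 0)) p = 0 := by
  refine laplacian_comp_coord hI hφ hp _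
    (h.inv_inducedMetric_apply_zero hI hp hk2 hf hdet (by simp)) ?_
  refine Finset.sum_eq_zero fun i _ => Finset.sum_eq_zero fun j _ => ?_
  rw [christoffel_inducedMetric (isOpen_setOf_apply_mem hI 0) (h.smooth_bScrollMap hI) hp,
    Finset.sum_eq_single 1 (fun l _ hl => by
      rw [h.inv_inducedMetric_zero_apply hI hp hk2 hf hdet hl, zero_mul]) (by simp),
    h.partialMap_one hI hp]
  by_cases hi : i = 0
  · subst hi
    by_cases hj : j = 1
    · rw [hj, h.inner_partialMap_zero_partialMap_one hI hp]; ring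
    · rw [h.inv_inducedMetric_zero_apply hI hp hk2 hf hdet hj]; ring
  by_cases hj : j = 0
  · subst hj
    by_cases hi : i = 1
    · rw [hi, partialMap_comm (isOpen_setOf_apply_mem hI 0) (h.smooth_bScrollMap hI) hp,
        h.inner_partialMap_zero_partialMap_one hI hp]; ring
    · rw [h.inv_inducedMetric_apply_zero hI hp hk2 hf hdet hi]; ring
  rw [h.inner_partialMap_partialMap_B hI hp hk2 hi hj]
  ring

end IsCartanFrame

/-! ### Alternating maps, determinants and duality for pseudo-orthonormal families. -/

section Alternating

variable {n : ℕ}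

theorem AlternatingMap.apply_eq_det_smul {W : Type*} [AddCommGroup W] [Module ℝ W]
    (f : (Fin n → ℝ) [⋀^Fin n]→ₗ[ℝ] W) (e : Fin n → Fin n → ℝ) :
    f e = (Matrix.of e).det • f fun i => Pi.single i 1 := by
  have hfg : f = (LinearMap.toSpanSingleton ℝ W (f fun i => Pi.single i 1)).compAlternatingMap
      (Pi.basisFun ℝ (Fin n)).det := by
    refine Module.Basis.ext_alternating (Pi.basisFun ℝ (Fin n)) fun v hv => ?_
    let τ : Equiv.Perm (Fin n) := Equiv.ofBijective v (Finite.injective_iff_bijective.1 hv)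
    have h1 : (fun i => Pi.basisFun ℝ (Fin n) (v i)) = (Pi.basisFun ℝ (Fin n)) ∘ τ := rfl
    have h2 : (fun i => Pi.single i (1 : ℝ) : Fin n → Fin n → ℝ) = Pi.basisFun ℝ (Fin n) := by
      funext i; simp
    rw [h1, h2, AlternatingMap.map_perm, AlternatingMap.map_perm]
    congr 1
    rw [LinearMap.compAlternatingMap_apply, Module.Basis.det_self, LinearMap.toSpanSingleton_apply,
      one_smul]
  conv_lhs => rw [hfg]
  rw [← Pi.basisFun_det_apply]
  rfl

theorem AlternatingMap.cons_apply_eq_det_smul {E W : Type*} [AddCommGroup E] [Module ℝ E]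
    [AddCommGroup W] [Module ℝ W] (f : E [⋀^Fin (n + 1)]→ₗ[ℝ] W) (y : E) (L : (Fin n → ℝ) →ₗ[ℝ] E)
    (e : Fin n → Fin n → ℝ) :
    f (Fin.cons y fun i => L (e i))
      = (Matrix.of e).det • f (Fin.cons y fun i => L (Pi.single i 1)) :=
  AlternatingMap.apply_eq_det_smul ((f.curryLeft y).compLinearMap L) e

/-- Expanded in the standard basis, a multilinear map is a polynomial in the coordinates of its
arguments. -/
theorem ContDiffOn.multilinearMap {E ι : Type*} [Fintype ι] [NormedAddCommGroup E]
    [NormedSpace ℝ E] {N : ℕ} (f : MultilinearMap ℝ (fun _ : ι => Fin N → ℝ) ℝ) {S : Set E}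
    {a : ι → E → Fin N → ℝ} (ha : ∀ i, ContDiffOn ℝ ∞ (a i) S) :
    ContDiffOn ℝ ∞ (fun q => f fun i => a i q) S := by
  classical
  have hf : ∀ v : ι → Fin N → ℝ, f v
      = ∑ r : ι → Fin N, (∏ i, v i (r i)) * f fun i => Pi.single (r i) 1 := by
    intro v
    conv_lhs => rw [show v = fun i => ∑ c, v i c • Pi.single c (1 : ℝ) from
      funext fun i => (by simp_rw [← Pi.single_smul, smul_eq_mul, mul_one, Finset.univ_sum_single])]
    rw [MultilinearMap.map_sum]
    exact Finset.sum_congr rfl fun r _ => by rw [MultilinearMap.map_smul_univ, smul_eq_mul]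
  exact ContDiffOn.congr (ContDiffOn.sum fun r _ => (contDiffOn_prod fun i _ =>
    contDiffOn_pi.1 (ha i) (r i)).mul contDiffOn_const) fun q _ => hf _

end Alternating

section PseudoOrthonormal

variable {s n : ℕ}

theorem mul_diagonal_mul_transpose_apply {N M : ℕ} (a b : Fin M → Fin N → ℝ) (i j : Fin M) :
    (Matrix.of a * Matrix.diagonal (fun c : Fin N => if (c : ℕ) < s then (-1 : ℝ) else 1) *
      (Matrix.of b).transpose) i j = pseudoInner s (a i) (b j) := by
  rw [Matrix.mul_apply]
  simp only [Matrix.mul_diagonal, Matrix.transpose_apply, Matrix.of_apply, pseudoInner]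
  exact Finset.sum_congr rfl fun c _ => by ring

theorem det_diagonal_sq {M : ℕ} (d : Fin M → ℝ) (hd : ∀ i, d i = 1 ∨ d i = -1) :
    (Matrix.diagonal d).det ^ 2 = 1 := by
  rw [Matrix.det_diagonal, ← Finset.prod_pow]
  exact Finset.prod_eq_one fun i _ => by rcases hd i with h | h <;> simp [h]

/-- The matrix of scalar products of `(v, Y)` with `(ν, Y)` has first column `(⟨v,ν⟩, 0, …, 0)` and
a diagonal `±1` block, so its determinant is `⟨v,ν⟩ d` with `d = ±1`. It also equals the product of
the two determinants and `det J = ±1`. Taking `v = ν` gives the square; comparing the general case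
with it gives the formula. -/
theorem det_cons_of_pseudoOrthonormal {ν : Fin (n + 2) → ℝ} {Y : Fin (n + 1) → Fin (n + 2) → ℝ}
    (hY : ∀ i j, i ≠ j → pseudoInner s (Y i) (Y j) = 0)
    (hYY : ∀ i, pseudoInner s (Y i) (Y i) = 1 ∨ pseudoInner s (Y i) (Y i) = -1)
    (hν : pseudoInner s ν ν = 1) (hνY : ∀ i, pseudoInner s (Y i) ν = 0) :
    (Matrix.of (Fin.cons ν Y : Fin (n + 2) → Fin (n + 2) → ℝ)).det ^ 2 = 1 ∧
    ∀ v, (Matrix.of (Fin.cons v Y : Fin (n + 2) → Fin (n + 2) → ℝ)).det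
      = pseudoInner s v ν * (Matrix.of (Fin.cons ν Y : Fin (n + 2) → Fin (n + 2) → ℝ)).det := by
  set J : Matrix (Fin (n + 2)) (Fin (n + 2)) ℝ :=
    Matrix.diagonal (fun c => if (c : ℕ) < s then (-1 : ℝ) else 1)
  set M : (Fin (n + 2) → ℝ) → Matrix (Fin (n + 2)) (Fin (n + 2)) ℝ :=
    fun v => Matrix.of (Fin.cons v Y : Fin (n + 2) → Fin (n + 2) → ℝ)
  set d := (Matrix.diagonal fun i => pseudoInner s (Y i) (Y i)).det
  have hJ : J.det ^ 2 = 1 := det_diagonal_sq _ fun i => by split_ifs <;> simp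
  have hd : d ^ 2 = 1 := det_diagonal_sq _ hYY
  have key : ∀ v, (M v).det * J.det * (M ν).det = pseudoInner s v ν * d := by
    intro v
    rw [← Matrix.det_mul, ← Matrix.det_transpose (M ν), ← Matrix.det_mul,
      Matrix.det_succ_column_zero, Fin.sum_univ_succ]
    simp only [J, M, mul_diagonal_mul_transpose_apply, Fin.cons_zero, Fin.cons_succ, hνY]
    have hsub : ((Matrix.of (Fin.cons v Y : Fin (n + 2) → Fin (n + 2) → ℝ) * J *
        (Matrix.of (Fin.cons ν Y : Fin (n + 2) → Fin (n + 2) → ℝ)).transpose).submatrix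
        (Fin.succAbove 0) Fin.succ) = Matrix.diagonal fun i => pseudoInner s (Y i) (Y i) := by
      ext i j
      simp only [Matrix.submatrix_apply, J, mul_diagonal_mul_transpose_apply, Fin.zero_succAbove,
        Fin.cons_succ, Matrix.diagonal_apply]
      split_ifs with hij
      · rw [hij]
      · exact hY i j hij
    simp only [J] at hsub
    rw [hsub]
    simp [d]
  have hνν := key ν
  rw [hν, one_mul] at hνν
  have hM : (M ν).det ^ 2 = 1 := by
    have h1 : ((M ν).det ^ 2) ^ 2 = 1 := by
      calc ((M ν).det ^ 2) ^ 2 = ((M ν).det * J.det * (M ν).det) ^ 2 := by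
            linear_combination -(M ν).det ^ 4 * hJ
        _ = 1 := by rw [hνν, hd]
    nlinarith [sq_nonneg (M ν).det]
  refine ⟨hM, fun v => ?_⟩
  have hJM : J.det * (M ν).det ≠ 0 := mul_ne_zero (fun h0 => by simp [h0] at hJ)
    fun h0 => by simp [h0] at hM
  refine mul_right_cancel₀ hJM ?_
  change (M v).det * _ = _ * (M ν).det * _
  linear_combination key v - pseudoInner s v ν * hνν

end PseudoOrthonormal

/-! ### The Gauss map in coordinates and its dual description. -/

section GaussMap

variable {s n : ℕ} {x : (Fin n → ℝ) → Fin (n + 2) → ℝ} {V : Set (Fin n → ℝ)}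
  {σ : (Fin n → ℝ) → ℝ} {p : Fin n → ℝ}

theorem inducedInner_eq_sum (x : (Fin n → ℝ) → Fin (n + 2) → ℝ) (p v w : Fin n → ℝ) :
    inducedInner s x p v w = ∑ a, ∑ b, v a * inducedMetric s x p a b * w b := by
  rw [inducedInner, fderiv_apply_eq_sum_partialMap, fderiv_apply_eq_sum_partialMap x p w,
    pseudoInner_sum_left]
  refine Finset.sum_congr rfl fun a _ => ?_
  rw [pseudoInner_sum_right]
  refine Finset.sum_congr rfl fun b _ => ?_
  rw [pseudoInner_smul_left, pseudoInner_smul_right, inducedMetric_apply]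
  ring

theorem IsOrthonormalFrame.det_sq_mul_det_inducedMetric {e : Fin n → Fin n → ℝ}
    (he : IsOrthonormalFrame s x p e) :
    (Matrix.of e).det ^ 2 * |(inducedMetric s x p).det| = 1 := by
  have h1 : Matrix.of e * inducedMetric s x p * (Matrix.of e).transpose
      = Matrix.diagonal fun i => inducedInner s x p (e i) (e i) := by
    ext i j
    have h2 : (Matrix.of e * inducedMetric s x p * (Matrix.of e).transpose) i j
        = inducedInner s x p (e i) (e j) := by
      rw [inducedInner_eq_sum, Matrix.mul_apply, Finset.sum_comm]
      refine Finset.sum_congr rfl fun b _ => ?_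
      rw [Matrix.mul_apply, Finset.sum_mul]
      rfl
    rw [h2, Matrix.diagonal_apply]
    split_ifs with hij
    · rw [hij]
    · exact he.1 i j hij
  have h3 := congrArg (fun M => |Matrix.det M|) h1
  simp only [Matrix.det_mul, Matrix.det_transpose, abs_mul] at h3
  have h4 := det_diagonal_sq _ he.2
  rw [show |(Matrix.diagonal fun i => inducedInner s x p (e i) (e i)).det| = 1 from
    (pow_eq_one_iff_of_nonneg (abs_nonneg _) two_ne_zero).1 (by rw [sq_abs, h4])] at h3
  rw [← sq_abs]
  linarith

/-- The pseudo-hyperbolic Gauss map in coordinates. -/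
noncomputable def coordGaussMap (s : ℕ) (x : (Fin n → ℝ) → Fin (n + 2) → ℝ)
    (σ : (Fin n → ℝ) → ℝ) (p : Fin n → ℝ) : ⋀[ℝ]^(n + 1) (Fin (n + 2) → ℝ) :=
  (σ p / √|(inducedMetric s x p).det|) • exteriorPower.ιMulti ℝ (n + 1)
    (Fin.cons (x p) (fun i => partialMap i x p) : Fin (n + 1) → Fin (n + 2) → ℝ)

theorem ιMulti_cons_fderiv (x : (Fin n → ℝ) → Fin (n + 2) → ℝ) (p : Fin n → ℝ)
    (e : Fin n → Fin n → ℝ) :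
    exteriorPower.ιMulti ℝ (n + 1)
      (Fin.cons (x p) (fun i => fderiv ℝ x p (e i)) : Fin (n + 1) → Fin (n + 2) → ℝ)
    = (Matrix.of e).det • exteriorPower.ιMulti ℝ (n + 1)
      (Fin.cons (x p) (fun i => partialMap i x p) : Fin (n + 1) → Fin (n + 2) → ℝ) :=
  AlternatingMap.cons_apply_eq_det_smul _ (x p) (fderiv ℝ x p).toLinearMap e

/-- Reversing one frame vector changes the sign of the determinant; dimension at least one is
needed. -/
theorem IsOrthonormalFrame.exists_isOrientedFrame {e : Fin (n + 1) → Fin (n + 1) → ℝ} {N : ℕ}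
    {x : (Fin (n + 1) → ℝ) → Fin N → ℝ} {σ : (Fin (n + 1) → ℝ) → ℝ} {p : Fin (n + 1) → ℝ}
    (he : IsOrthonormalFrame s x p e) (hdet : (Matrix.of e).det ≠ 0) (hσ : σ p ≠ 0) :
    ∃ e', IsOrientedFrame s x σ p e' := by
  rcases (mul_ne_zero hσ hdet).lt_or_gt with hlt | hgt
  · let c : Fin (n + 1) → ℝ := fun i => if i = 0 then -1 else 1
    have hc : ∀ i, c i * c i = 1 := fun i => by simp only [c]; split_ifs <;> norm_num
    have hin : ∀ i j, inducedInner s x p (c i • e i) (c j • e j)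
        = c i * c j * inducedInner s x p (e i) (e j) := fun i j => by
      simp only [inducedInner, map_smul, pseudoInner_smul_left, pseudoInner_smul_right]; ring
    refine ⟨fun i => c i • e i, ⟨fun i j hij => by rw [hin, he.1 i j hij, mul_zero], fun i => ?_⟩,
      ?_⟩
    · rw [hin, hc, one_mul]; exact he.2 i
    · have h1 := Matrix.det_mul_column c (Matrix.of e)
      have h2 : ∏ i, c i = -1 := by simp [c]
      rw [h2] at h1
      change 0 < σ p * (Matrix.of fun i j => c i * Matrix.of e i j).det
      rw [h1]
      linarith
  · exact ⟨e, he, hgt⟩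

/-- Orthonormality fixes the size of the determinant and the orientation its sign. This is why the
Gauss map does not depend on the frame and has the closed form `coordGaussMap`. -/
theorem IsOrientedFrame.det_eq {e : Fin n → Fin n → ℝ} (he : IsOrientedFrame s x σ p e)
    (hσ : σ p = 1 ∨ σ p = -1) :
    (Matrix.of e).det = σ p / √|(inducedMetric s x p).det| := by
  have h1 := he.1.det_sq_mul_det_inducedMetric
  have h2 := he.2
  set d := (Matrix.of e).det
  set G := |(inducedMetric s x p).det|
  have hG : 0 < G := by
    refine lt_of_le_of_ne (abs_nonneg _) fun h0 => ?_
    rw [← h0] at h1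
    simp at h1
  have hs : 0 < √G := Real.sqrt_pos.2 hG
  have h3 : (d * √G) ^ 2 = 1 := by rw [mul_pow, Real.sq_sqrt hG.le, h1]
  rw [eq_div_iff hs.ne']
  rcases eq_or_eq_neg_of_sq_eq_sq _ 1 (h3.trans (one_pow 2).symm) with h | h <;> rcases hσ with h' | h' <;> rw [h'] at h2 ⊢
  all_goals nlinarith

theorem IsOrientedFrame.coordGaussMap_eq {e : Fin n → Fin n → ℝ}
    (he : IsOrientedFrame s x σ p e) (hσ : σ p = 1 ∨ σ p = -1) :
    coordGaussMap s x σ p = exteriorPower.ιMulti ℝ (n + 1)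
      (Fin.cons (x p) (fun i => fderiv ℝ x p (e i)) : Fin (n + 1) → Fin (n + 2) → ℝ) := by
  rw [ιMulti_cons_fderiv, he.det_eq hσ, coordGaussMap]

theorem IsOrientationOn.contDiffOn (hσ : IsOrientationOn V σ) (hV : IsOpen V) :
    ContDiffOn ℝ ∞ σ V := by
  intro p hp
  have hev : ∀ᶠ q in nhds p, σ q = σ p := by
    have h1 : ∀ᶠ q in nhds p, 0 < σ q * σ p := by
      have hc : ContinuousAt (fun q => σ q * σ p) p :=
        (hσ.1.continuousAt (hV.mem_nhds hp)).mul continuousAt_const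
      refine hc.eventually (lt_mem_nhds ?_)
      rcases hσ.2 p hp with h | h <;> simp [h]
    filter_upwards [h1, hV.mem_nhds hp] with q hq hqV
    rcases hσ.2 p hp with h | h <;> rcases hσ.2 q hqV with h' | h' <;> rw [h, h'] at hq ⊢ <;>
      norm_num at hq
  exact ((contDiffAt_const (c := σ p)).congr_of_eventuallyEq hev).contDiffWithinAt

theorem isSmoothMapOn_coordGaussMap (hV : IsOpen V) (hx : ContDiffOn ℝ ∞ x V)
    (hσ : IsOrientationOn V σ) (hdet : ∀ p ∈ V, (inducedMetric s x p).det ≠ 0) :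
    IsSmoothMapOn V (coordGaussMap s x σ) := by
  intro l
  have hX : ∀ i, ContDiffOn ℝ ∞ (partialMap i x) V := contDiffOn_partialMap hV hx
  have hg : ContDiffOn ℝ ∞ (fun q => (inducedMetric s x q).det) V :=
    ContDiffOn.multilinearMap (Matrix.detRowAlternating (R := ℝ) (n := Fin n)).toMultilinearMap
      (a := fun i q => inducedMetric s x q i)
      fun i => contDiffOn_pi.2 fun j => (hX i).pseudoInner (hX j)
  have hsq : ContDiffOn ℝ ∞ (fun q => √|(inducedMetric s x q).det|) V := fun q hq =>
    (((hg.contDiffAt (hV.mem_nhds hq)).abs (hdet q hq)).sqrt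
      (abs_ne_zero.2 (hdet q hq))).contDiffWithinAt
  have hl : ContDiffOn ℝ ∞ (fun q => l (exteriorPower.ιMulti ℝ (n + 1)
      (Fin.cons (x q) (fun i => partialMap i x q) : Fin (n + 1) → Fin (n + 2) → ℝ))) V := by
    refine (ContDiffOn.multilinearMap (l.compAlternatingMap
      (exteriorPower.ιMulti ℝ (n + 1))).toMultilinearMap (a := Fin.cons x fun i => partialMap i x)
      (Fin.cases hx hX)).congr fun q _ => ?_
    have hcons : (Fin.cons (x q) (fun i => partialMap i x q) : Fin (n + 1) → Fin (n + 2) → ℝ)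
        = fun i => (Fin.cons x (fun i => partialMap i x) :
          Fin (n + 1) → (Fin n → ℝ) → Fin (n + 2) → ℝ) i q :=
      funext (Fin.cases rfl fun _ => rfl)
    rw [hcons]
    rfl
  simp only [coordGaussMap, map_smul, smul_eq_mul]
  exact ((hσ.contDiffOn hV).div hsq fun q hq =>
    (Real.sqrt_pos.2 (abs_pos.2 (hdet q hq))).ne').mul hl

/-- The linear form `ω ↦ v ∧ ω` on `⋀^{n+1} ℝ^{n+2}`, linear in `v`. -/
noncomputable def wedgeForm (n : ℕ) :
    (Fin (n + 2) → ℝ) →ₗ[ℝ] Module.Dual ℝ (⋀[ℝ]^(n + 1) (Fin (n + 2) → ℝ)) :=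
  (exteriorPower.alternatingMapLinearEquiv (R := ℝ) (n := n + 1) (M := Fin (n + 2) → ℝ)
    (N := ℝ)).toLinearMap ∘ₗ (Matrix.detRowAlternating (R := ℝ) (n := Fin (n + 2))).curryLeft

theorem wedgeForm_ιMulti (v : Fin (n + 2) → ℝ) (Y : Fin (n + 1) → Fin (n + 2) → ℝ) :
    wedgeForm n v (exteriorPower.ιMulti ℝ (n + 1) Y)
      = (Matrix.of (Fin.cons v Y : Fin (n + 2) → Fin (n + 2) → ℝ)).det :=
  exteriorPower.alternatingMapLinearEquiv_apply_ιMulti _ _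

/-- The Gauss map is, up to sign, dual to a unit normal field `N`. -/
theorem wedgeForm_coordGaussMap {e : Fin n → Fin n → ℝ} (he : IsOrientedFrame s x σ p e)
    (hσ : σ p = 1 ∨ σ p = -1) {N : Fin (n + 2) → ℝ} (hN : pseudoInner s N N = 1)
    (hxx : pseudoInner s (x p) (x p) = -1) (hxN : pseudoInner s (x p) N = 0)
    (hdx : ∀ w, pseudoInner s (fderiv ℝ x p w) (x p) = 0)
    (hdN : ∀ w, pseudoInner s (fderiv ℝ x p w) N = 0) :
    wedgeForm n N (coordGaussMap s x σ p) ^ 2 = 1 ∧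
    ∀ v, wedgeForm n v (coordGaussMap s x σ p)
      = pseudoInner s v N * wedgeForm n N (coordGaussMap s x σ p) := by
  rw [he.coordGaussMap_eq hσ]
  simp only [wedgeForm_ιMulti]
  refine det_cons_of_pseudoOrthonormal (s := s) ?_ ?_ hN ?_
  · intro i j hij
    induction i using Fin.cases with
    | zero =>
      induction j using Fin.cases with
      | zero => exact absurd rfl hij
      | succ j => rw [pseudoInner_comm]; exact hdx _
    | succ i =>
      induction j using Fin.cases with
      | zero => exact hdx _
      | succ j => exact he.1.1 i j fun h0 => hij (by rw [h0])
  · exact Fin.cases (.inr hxx) fun i => he.1.2 i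
  · exact Fin.cases hxN fun i => hdN _

end GaussMap

/-! ### The Gauss map of the hypersurface is of infinite type. -/

namespace IsCartanFrame

variable {m : ℕ} {I : Set ℝ} {γ A B C : ℝ → Fin (m + 2 + 2) → ℝ}
  {Z : Fin m → ℝ → Fin (m + 2 + 2) → ℝ} {k : ℕ → ℝ → ℝ}
  (h : IsCartanFrame I γ A B C Z k) (hI : IsOpen I) (hk2 : ∀ s ∈ I, k 2 s ^ 2 = 1)
include h hI hk2

/-- Continuity of the factor is read off from its expression `-⟨∂_s x, B⟩`, not from any regularity
of `k 3`. -/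
theorem isOpen_immersionDomain :
    IsOpen {p : Fin (m + 2) → ℝ | p 0 ∈ I ∧ 1 + k 3 (p 0) * extendZero (zCoord p) 0 ≠ 0} := by
  have hΩ : IsOpen {p : Fin (m + 2) → ℝ | p 0 ∈ I} := isOpen_setOf_apply_mem hI 0
  have hB : ContDiffOn ℝ ∞ (fun p : Fin (m + 2) → ℝ => B (p 0)) {p | p 0 ∈ I} :=
    h.smooth_B.comp (contDiff_apply ℝ ℝ 0).contDiffOn fun _ hp => hp
  have hc := ((contDiffOn_partialMap hΩ (h.smooth_bScrollMap hI) 0).pseudoInner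
    (s := 2) hB).continuousOn
  refine (congrArg IsOpen (Set.ext fun p => ?_)).mpr
    (hc.isOpen_inter_preimage hΩ (isOpen_compl_singleton (x := (0 : ℝ))))
  refine and_congr_right fun hp => ?_
  have := h.inner_partialMap_B hI hp hk2 0
  simp only [Set.mem_preimage, this, if_true, Set.mem_compl_iff, Set.mem_singleton_iff,
    neg_eq_zero, ne_eq]

theorem isLorentzianHypersurface_bScrollMap {U : Set (Fin (m + 2) → ℝ)}
    (hU : ∀ p ∈ U, p 0 ∈ I ∧ 1 + k 3 (p 0) * extendZero (zCoord p) 0 ≠ 0) :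
    IsLorentzianHypersurface (bScrollMap γ B C Z (k 2)) U where
  smooth := (h.smooth_bScrollMap hI).mono fun p hp => (hU p hp).1
  mem_space p hp := h.inner_map_self (hU p hp).1 (hk2 _ (hU p hp).1)
  immersion p hp := (h.injective_fderiv_iff hI (hU p hp).1 hk2).2 (hU p hp).2
  lorentzian p hp := h.isLorentzianAt_bScrollMap hI (hU p hp).1 hk2 (hU p hp).2

variable {V : Set (Fin (m + 2) → ℝ)} {σ : (Fin (m + 2) → ℝ) → ℝ}
  (hV : ∀ p ∈ V, p 0 ∈ I ∧ 1 + k 3 (p 0) * extendZero (zCoord p) 0 ≠ 0)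
include hV

theorem det_inducedMetric_ne_zero {p : Fin (m + 2) → ℝ} (hp : p ∈ V) :
    (inducedMetric 2 (bScrollMap γ B C Z (k 2)) p).det ≠ 0 := by
  obtain ⟨e, he, -⟩ := h.isLorentzianAt_bScrollMap hI (hV p hp).1 hk2 (hV p hp).2
  intro h0
  simpa [h0] using he.det_sq_mul_det_inducedMetric

variable (hσ : IsOrientationOn V σ)
include hσ

theorem exists_isOrientedFrame {p : Fin (m + 2) → ℝ} (hp : p ∈ V) :
    ∃ e, IsOrientedFrame 2 (bScrollMap γ B C Z (k 2)) σ p e := by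
  obtain ⟨e, he, -⟩ := h.isLorentzianAt_bScrollMap hI (hV p hp).1 hk2 (hV p hp).2
  refine he.exists_isOrientedFrame (fun h0 => ?_) fun h0 => ?_
  · simpa [h0] using he.det_sq_mul_det_inducedMetric
  · rcases hσ.2 p hp with h1 | h1 <;> norm_num [h0] at h1

theorem isPseudoHyperbolicGaussMap_coordGaussMap :
    IsPseudoHyperbolicGaussMap 2 (bScrollMap γ B C Z (k 2)) V σ
      (coordGaussMap 2 (bScrollMap γ B C Z (k 2)) σ) := fun p hp =>
  ⟨h.exists_isOrientedFrame hI hk2 hV hσ hp, fun _ he => he.coordGaussMap_eq (hσ.2 p hp)⟩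

theorem wedgeForm_coordGaussMap_bScrollMap {p : Fin (m + 2) → ℝ} (hp : p ∈ V) :
    wedgeForm (m + 2) (bScrollMap γ B C Z (k 2) p - nullField γ C (k 2) (p 0))
        (coordGaussMap 2 (bScrollMap γ B C Z (k 2)) σ p) ^ 2 = 1 ∧
      ∀ v, wedgeForm (m + 2) v (coordGaussMap 2 (bScrollMap γ B C Z (k 2)) σ p)
        = pseudoInner 2 v (bScrollMap γ B C Z (k 2) p - nullField γ C (k 2) (p 0)) *
          wedgeForm (m + 2) (bScrollMap γ B C Z (k 2) p - nullField γ C (k 2) (p 0))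
            (coordGaussMap 2 (bScrollMap γ B C Z (k 2)) σ p) := by
  obtain ⟨e, he⟩ := h.exists_isOrientedFrame hI hk2 hV hσ hp
  have hpI := (hV p hp).1
  have hxx := h.inner_map_self hpI (hk2 _ hpI)
  have hxη := h.inner_map_nullField hpI (hk2 _ hpI)
  refine wedgeForm_coordGaussMap he (hσ.2 p hp) ?_ hxx ?_ (h.inner_fderiv_self hI hpI hk2) fun w => ?_
  · rw [pseudoInner_sub_left, pseudoInner_sub_right, pseudoInner_sub_right,
      pseudoInner_comm (nullField γ C (k 2) (p 0)) (bScrollMap γ B C Z (k 2) p), hxx, hxη,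
      h.inner_nullField_self hpI (hk2 _ hpI)]
    norm_num
  · rw [pseudoInner_sub_right, hxx, hxη, sub_self]
  · rw [pseudoInner_sub_right, h.inner_fderiv_self hI hpI hk2, h.inner_fderiv_nullField hI hpI hk2,
      sub_self]

theorem isOfInfiniteType_coordGaussMap (hVo : IsOpen V) (hVne : V.Nonempty) :
    IsOfInfiniteType (inducedMetric 2 (bScrollMap γ B C Z (k 2))) V
      (coordGaussMap 2 (bScrollMap γ B C Z (k 2)) σ) := by
  have hx : ContDiffOn ℝ ∞ (bScrollMap γ B C Z (k 2)) V :=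
    (h.smooth_bScrollMap hI).mono fun p hp => (hV p hp).1
  have hsmooth := isSmoothMapOn_coordGaussMap hVo hx hσ
    fun p hp => h.det_inducedMetric_ne_zero hI hk2 hV hp
  refine ⟨hsmooth, ?_⟩
  rintro ⟨r, ψ, c, -, hψ, hsum⟩
  obtain ⟨p₀, hp₀⟩ := hVne
  set X := bScrollMap γ B C Z (k 2) with hX
  set η := nullField γ C (k 2) with hη
  set ν := coordGaussMap 2 X σ with hν
  set δ : (Fin (m + 2) → ℝ) → ℝ := fun p => wedgeForm (m + 2) (X p - η (p 0)) (ν p) with hδ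
  have hwedge := fun p hp => h.wedgeForm_coordGaussMap_bScrollMap hI hk2 hV hσ (p := p) hp
  have hηV : ContDiffOn ℝ ∞ (fun p : Fin (m + 2) → ℝ => η (p 0)) V :=
    (h.smooth_nullField hI).comp (contDiff_apply ℝ ℝ 0).contDiffOn fun p hp => (hV p hp).1
  -- Smoothness of `ν` is known only against fixed linear forms, so the moving vector `x - η` is
  -- expanded in the standard basis.
  have hδcont : ContinuousOn δ V := by
    have h1 : ∀ p, δ p = ∑ i, (X p - η (p 0)) i * wedgeForm (m + 2) (Pi.single i 1) (ν p) := by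
      intro p
      simp only [hδ]
      rw [LinearMap.pi_apply_eq_sum_univ (wedgeForm (m + 2)) (X p - η (p 0)), LinearMap.sum_apply]
      refine Finset.sum_congr rfl fun i _ => ?_
      rw [LinearMap.smul_apply, smul_eq_mul]
      congr 3
      funext j
      simp [Pi.single_apply, eq_comm]
    exact (ContDiffOn.sum fun i _ => (contDiffOn_pi.1 (hx.sub hηV) i).mul
      (hsmooth _)).continuousOn.congr fun p _ => h1 p
  -- Since `δ² = 1`, `δ` is constant on this open neighbourhood of `p₀`.
  set V' := V ∩ (fun p => δ p * δ p₀) ⁻¹' Set.Ioi 0 with hV'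
  have hV'o : IsOpen V' := (hδcont.mul continuousOn_const).isOpen_inter_preimage hVo isOpen_Ioi
  have hp₀' : p₀ ∈ V' := ⟨hp₀, by
    have := (hwedge p₀ hp₀).1
    change 0 < δ p₀ * δ p₀
    change δ p₀ ^ 2 = 1 at this
    nlinarith⟩
  have hδconst : ∀ p ∈ V', δ p = δ p₀ := by
    rintro p ⟨hp, hpos⟩
    have h1 : δ p ^ 2 = δ p₀ ^ 2 := (hwedge p hp).1.trans (hwedge p₀ hp₀).1.symm
    rcases sq_eq_sq_iff_eq_or_eq_neg.1 h1 with h2 | h2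
    · exact h2
    · change 0 < δ p * δ p₀ at hpos
      rw [h2] at hpos
      nlinarith [sq_nonneg (δ p₀)]
  -- This vector satisfies `⟨v, η⟩ = -1` at `p₀`, so the harmonic function `G` below does not vanish
  -- there.
  set v := γ (p₀ 0) with hv
  have hφ : ∀ a : ℝ, ContDiffOn ℝ ∞ (fun t => a * pseudoInner 2 v (η t)) I := fun a =>
    contDiffOn_const.mul (contDiffOn_const.pseudoInner (h.smooth_nullField hI))
  have hφV : ∀ a : ℝ, ContDiffOn ℝ ∞ (fun p : Fin (m + 2) → ℝ => a * pseudoInner 2 v (η (p 0))) V' :=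
    fun a => (contDiffOn_const.mul (contDiffOn_const.pseudoInner hηV)).mono Set.inter_subset_left
  -- On `V'` the component `F = v ∧ ν` is `δ(p₀)(⟨v,x⟩ - ⟨v,η⟩)`; thus `ΔF = G = -(m+2) δ(p₀)
  -- ⟨v,η⟩`, a function of `s` alone, and `ΔG = 0`.
  have hzero := laplacian_eq_zero_of_sum_eigenfunctions (inducedMetric 2 X)
    (a := fun i p => wedgeForm (m + 2) v (ψ i p)) (c := c)
    (F := fun p => wedgeForm (m + 2) v (ν p))
    (G := fun p => -((m + 2) * δ p₀) * pseudoInner 2 v (η (p 0))) hV'o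
    (fun i => ((hψ i).1 _).mono Set.inter_subset_left)
    (fun i p hp => (hψ i).2.2 _ p hp.1) (fun p hp => by rw [hsum p hp.1, map_sum])
    (fun p hp => ?_) (fun p hp => ?_) p₀ hp₀'
  · have h1 := h.inner_γ_nullField (hV p₀ hp₀).1
    rw [← hη, ← hv] at h1
    rw [h1] at hzero
    have h2 := (hwedge p₀ hp₀).1
    change δ p₀ ^ 2 = 1 at h2
    have h3 : δ p₀ = 0 := by
      have h4 : ((m : ℝ) + 2) * δ p₀ = 0 := by linarith
      exact (mul_eq_zero.1 h4).resolve_left (by positivity)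
    norm_num [h3] at h2
  · obtain ⟨hpI, hf⟩ := hV p hp.1
    have hdet := isUnit_iff_ne_zero.2 (h.det_inducedMetric_ne_zero hI hk2 hV hp.1)
    have hF : ∀ q ∈ V', wedgeForm (m + 2) v (ν q)
        = δ p₀ * pseudoInner 2 v (X q) + -δ p₀ * pseudoInner 2 v (η (q 0)) := by
      intro q hq
      rw [(hwedge q hq.1).2 v, pseudoInner_sub_right, ← hδconst q hq]
      change _ * δ q = _
      ring
    rw [laplacian_congr _ (Filter.eventuallyEq_of_mem (hV'o.mem_nhds hp) hF),
      laplacian_const_mul_add _ hV'o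
        ((contDiffOn_const.pseudoInner hx).mono Set.inter_subset_left) (hφV _) _ hp,
      h.laplacian_inner_bScrollMap hI hpI hk2 hf hdet,
      h.laplacian_comp_apply_zero hI hpI hk2 hf hdet (hφ _)]
    ring
  · obtain ⟨hpI, hf⟩ := hV p hp.1
    have hdet := isUnit_iff_ne_zero.2 (h.det_inducedMetric_ne_zero hI hk2 hV hp.1)
    have key := h.laplacian_comp_apply_zero hI hpI hk2 hf hdet (hφ (-((m + 2) * δ p₀)))
    exact key

end IsCartanFrame

theorem mainTheorem4 (m : ℕ) (I : Set ℝ) (hI_open : IsOpen I) (hI_conn : I.OrdConnected)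
    (γ A B C : ℝ → Fin (m + 2 + 2) → ℝ) (Z : Fin m → ℝ → Fin (m + 2 + 2) → ℝ) (k : ℕ → ℝ → ℝ)
    (hframe : IsCartanFrame I γ A B C Z k)
    (hk1 : ∀ s ∈ I, k 1 s ≠ 0)
    (hk2 : ∀ s ∈ I, k 2 s ^ 2 = 1)
    (hk : ∀ i, 3 ≤ i → i ≤ m → ∃ c : ℝ, c ≠ 0 ∧ ∀ s ∈ I, k i s = c) :
    (∀ p : Fin (m + 2) → ℝ, p 0 ∈ I →
      (Function.Injective (fderiv ℝ (bScrollMap γ B C Z (k 2)) p) ↔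
        1 + k 3 (p 0) * extendZero (zCoord p) 0 ≠ 0)) ∧
    ∀ U : Set (Fin (m + 2) → ℝ),
      U = {p | p 0 ∈ I ∧ 1 + k 3 (p 0) * extendZero (zCoord p) 0 ≠ 0} →
      IsOpen U ∧
      IsLorentzianHypersurface (bScrollMap γ B C Z (k 2)) U ∧
      ∀ V : Set (Fin (m + 2) → ℝ), IsOpen V → V.Nonempty → V ⊆ U →
        ∀ σ : (Fin (m + 2) → ℝ) → ℝ, IsOrientationOn V σ →
          ∃ ν : (Fin (m + 2) → ℝ) → ⋀[ℝ]^(m + 2 + 1) (Fin (m + 2 + 2) → ℝ),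
            IsPseudoHyperbolicGaussMap 2 (bScrollMap γ B C Z (k 2)) V σ ν ∧
            IsOfInfiniteType (inducedMetric 2 (bScrollMap γ B C Z (k 2))) V ν := by
  refine ⟨fun p hp => hframe.injective_fderiv_iff hI_open hp hk2, ?_⟩
  rintro U rfl
  refine ⟨hframe.isOpen_immersionDomain hI_open hk2,
    hframe.isLorentzianHypersurface_bScrollMap hI_open hk2 fun p hp => hp, ?_⟩
  intro V hV hVne hVU σ hσ
  exact ⟨coordGaussMap 2 (bScrollMap γ B C Z (k 2)) σ,
    hframe.isPseudoHyperbolicGaussMap_coordGaussMap hI_open hk2 (fun p hp => hVU hp) hσ,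
    hframe.isOfInfiniteType_coordGaussMap hI_open hk2 (fun p hp => hVU hp) hσ hV hVne⟩
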